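/- Let $K$ be an imaginary quadratic field, $\overline{K}$ an algebraic closure of $K$, and $p \geq 5$ a prime number that splits in $K$ as $(p) = \mathfrak{p}\overline{\mathfrak{p}}$ with $\mathfrak{p} \neq \overline{\mathfrak{p}}$. Let $E$ be an elliptic curve over $\mathbb{Q}$ with good reduction at $p$ and with complex multiplication by the ring of integers $\mathcal{O}_K$ of $K$, the action being given by a ring isomorphism $\mathcal{O}_K \simeq \mathrm{End}_K(E)$, $a \mapsto [a]$. Put $E[\mathfrak{p}^{\infty}] = \{P \in E(\overline{K}) : \exists n \geq 0,\ [a]P = 0 \text{ for all } a \in \mathfrak{p}^n\}$; this is a discrete $\mathrm{Gal}(\overline{K}/K)$-module. Let $L \subset \overline{K}$ be a finite abelian extension of $K$ and let $L^{\mathfrak{p}} = L(E[\mathfrak{p}^{\infty}])$ be the field generated over $L$ by the coordinates of the points of $E[\mathfrak{p}^{\infty}]$. Let $S$ be a finite set of finite places of $K$ with $\mathfrak{p} \in S$ and $\overline{\mathfrak{p}} \notin S$. For $F \in \{L, L^{\mathfrak{p}}\}$ define the $S$-imprimitive Selmer group $$\mathrm{Sel}_S(E/F)[\mathfrak{p}^{\infty}]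 = \ker\Big( H^1(F, E[\mathfrak{p}^{\infty}]) \to \prod_{v \notin S} H^1(F \otimes_K K_v, E[\mathfrak{p}^{\infty}]) \Big),$$ where $v$ runs over the finite places of $K$ outside $S$ (so $v = \overline{\mathfrak{p}}$ is included) and $H^1$ is continuous Galois cohomology; the kernel consists of the classes whose restriction to $H^1(F_w, E[\mathfrak{p}^{\infty}])$ vanishes for every place $w$ of $F$ above a finite place $v \notin S$ of $K$. Then the restriction map $H^1(L, E[\mathfrak{p}^{\infty}]) \to H^1(L^{\mathfrak{p}}, E[\mathfrak{p}^{\infty}])$ induces an isomorphism of abelian groups $$\mathrm{Sel}_S(E/L)[\mathfrak{p}^{\infty}] \overset{\sim}{\longrightarrow} \big(\mathrm{Sel}_S(E/L^{\mathfrak{p}})[\mathfrak{p}^{\infty}]\big)^{\mathrm{Gal}(L^{\mathfrak{p}}/L)},$$ and the restriction map commutes with the action of $\mathrm{Gal}(\overline{K}/K)$ on both cohomology groups. -/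

import Mathlib

open NumberField IsDedekindDomain

universe u v w

section Cohomology

/-- Continuous 1-cocycles (crossed homomorphisms) of a topological group `G` with values in the
discrete `G`-module `A`; the action is given by `ρ`, and a map to a discrete space is continuous
exactly when it is locally constant. -/
def contZ1 {G : Type*} {A : Type*} [Group G] [TopologicalSpace G] [AddCommGroup A]
    (ρ : G →* AddMonoid.End A) : AddSubgroup (G → A) where
  carrier := {f | IsLocallyConstant f ∧ ∀ g h, f (g * h) = f g + ρ g (f h)}
  zero_mem' := ⟨IsLocallyConstant.const 0, fun g h => by simp⟩
  add_mem' := by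
    rintro a b ⟨ha, ha'⟩ ⟨hb, hb'⟩
    refine ⟨ha.add hb, fun g h => ?_⟩
    simp only [Pi.add_apply, ha', hb', map_add]
    abel
  neg_mem' := by
    rintro a ⟨ha, ha'⟩
    refine ⟨ha.neg, fun g h => ?_⟩
    simp only [Pi.neg_apply, ha', map_neg]
    abel

/-- 1-coboundaries (principal crossed homomorphisms). -/
def contB1 {G : Type*} {A : Type*} [Group G] [AddCommGroup A]
    (ρ : G →* AddMonoid.End A) : AddSubgroup (G → A) where
  carrier := {f | ∃ a : A, ∀ g, f g = ρ g a - a}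
  zero_mem' := ⟨0, fun g => by simp⟩
  add_mem' := by
    rintro a b ⟨x, hx⟩ ⟨y, hy⟩
    refine ⟨x + y, fun g => ?_⟩
    simp only [Pi.add_apply, hx, hy, map_add]
    abel
  neg_mem' := by
    rintro a ⟨x, hx⟩
    refine ⟨-x, fun g => ?_⟩
    simp only [Pi.neg_apply, hx, map_neg]
    abel

/-- The first continuous cohomology group `H¹(G, A)` of the discrete `G`-module `A`. -/
abbrev contH1 {G : Type*} {A : Type*} [Group G] [TopologicalSpace G] [AddCommGroup A]
    (ρ : G →* AddMonoid.End A) : Type _ :=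
  contZ1 ρ ⧸ (contB1 ρ).addSubgroupOf (contZ1 ρ)

/-- The functoriality of cocycles for a pair of compatible maps `φ : H → G` and `u : A → B`. -/
def contZ1Map {G H : Type*} {A B : Type*} [Group G] [TopologicalSpace G] [Group H]
    [TopologicalSpace H] [AddCommGroup A] [AddCommGroup B]
    (ρ : G →* AddMonoid.End A) (ρ' : H →* AddMonoid.End B)
    (φ : H →* G) (hφ : Continuous φ) (u : A →+ B) (hu : ∀ h a, u (ρ (φ h) a) = ρ' h (u a)) :
    contZ1 ρ →+ contZ1 ρ' where
  toFun f := ⟨fun h => u (f.1 (φ h)),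
    ((f.2.1.comp_continuous hφ).comp u), fun g h => by simp [f.2.2, hu]⟩
  map_zero' := by ext; simp
  map_add' a b := by ext; simp

/-- The map `H¹(G, A) → H¹(H, B)`, `[f] ↦ [u ∘ f ∘ φ]`, for a pair of compatible maps
`φ : H → G` and `u : A → B`. -/
def contH1Map {G H : Type*} {A B : Type*} [Group G] [TopologicalSpace G] [Group H]
    [TopologicalSpace H] [AddCommGroup A] [AddCommGroup B]
    (ρ : G →* AddMonoid.End A) (ρ' : H →* AddMonoid.End B)
    (φ : H →* G) (hφ : Continuous φ) (u : A →+ B) (hu : ∀ h a, u (ρ (φ h) a) = ρ' h (u a)) :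
    contH1 ρ →+ contH1 ρ' :=
  QuotientAddGroup.map _ _ (contZ1Map ρ ρ' φ hφ u hu) (by
    rintro f ⟨a, ha⟩
    refine ⟨u a, fun h => ?_⟩
    have h1 : f.1 (φ h) = ρ (φ h) a - a := ha (φ h)
    change u (f.1 (φ h)) = _
    rw [h1, map_sub, hu])

end Cohomology

section Galois

variable {K : Type u} {Kbar : Type v} [Field K] [Field Kbar] [Algebra K Kbar]
  {A : Type w} [AddCommGroup A]

/-- `H¹(F, A)`: the continuous cohomology of `Gal(Kbar/F)` with values in the
`Gal(Kbar/K)`-module `A`, for an intermediate field `F` of `Kbar/K`. -/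
abbrev galH1 (ρ : Gal(Kbar/K) →* AddMonoid.End A) (F : IntermediateField K Kbar) : Type _ :=
  contH1 (ρ.comp F.fixingSubgroup.subtype)

/-- The restriction map `H¹(F, A) → H¹(F', A)` for `F ≤ F'`. -/
def galRes (ρ : Gal(Kbar/K) →* AddMonoid.End A) {F F' : IntermediateField K Kbar} (h : F ≤ F') :
    galH1 ρ F →+ galH1 ρ F' :=
  contH1Map _ _ (Subgroup.inclusion (IntermediateField.fixingSubgroup_antitone h))
    (continuous_inclusion (IntermediateField.fixingSubgroup_antitone h))
    (AddMonoidHom.id A) (fun _ _ => rfl)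

/-- The action of `σ ∈ Gal(Kbar/K)` on `H¹(F, A)` for `F/K` Galois: the class of `f` is sent
to the class of `g ↦ σ f(σ⁻¹ g σ)`. It only depends on the restriction of `σ` to `F`, and this is
the usual action of `Gal(F/K)` on `H¹(F, A)`. -/
def galConj [IsGalois K Kbar] (ρ : Gal(Kbar/K) →* AddMonoid.End A) (F : IntermediateField K Kbar)
    [IsGalois K F] (σ : Gal(Kbar/K)) : galH1 ρ F →+ galH1 ρ F :=
  contH1Map _ _ (MulAut.conjNormal (H := F.fixingSubgroup) σ⁻¹).toMonoidHom
    (by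
      refine Continuous.subtype_mk (f := fun g : F.fixingSubgroup => σ⁻¹ * (g : Gal(Kbar/K)) * σ⁻¹⁻¹) ?_ _
      fun_prop)
    (ρ σ) (by
      intro g a
      change ρ σ (ρ ((MulAut.conjNormal σ⁻¹ g : F.fixingSubgroup) : Gal(Kbar/K)) a) = ρ g (ρ σ a)
      have h1 : σ * (σ⁻¹ * (g : Gal(Kbar/K)) * σ⁻¹⁻¹) = g * σ := by group
      rw [MulAut.conjNormal_apply]
      change (ρ σ * ρ (σ⁻¹ * (g : Gal(Kbar/K)) * σ⁻¹⁻¹)) a = (ρ g * ρ σ) a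
      rw [← map_mul, h1, map_mul])

end Galois

section Local

variable {K : Type u} {Kbar : Type v} [Field K] [Field Kbar] [Algebra K Kbar] [Normal K Kbar]
  {Kv : Type u} {Ω : Type w} [Field Kv] [Field Ω] [Algebra K Kv] [Algebra Kv Ω] [Algebra K Ω]
  [IsScalarTower K Kv Ω]

/-- For a `K`-embedding `τ : Kbar → Ω` of a normal extension of `K`, the homomorphism
`Gal(Ω/Kv) → Gal(Kbar/K)`, `g ↦ τ⁻¹ ∘ g ∘ τ`. -/
noncomputable def localToGlobal (τ : Kbar →ₐ[K] Ω) : Gal(Ω/Kv) →* Gal(Kbar/K) :=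
  letI : Algebra Kbar Ω := τ.toRingHom.toAlgebra
  haveI : IsScalarTower K Kbar Ω := IsScalarTower.of_algebraMap_eq' τ.comp_algebraMap.symm
  (AlgEquiv.restrictNormalHom Kbar).comp (MonoidHom.mk' (fun g : Gal(Ω/Kv) => g.restrictScalars K) (fun _ _ => rfl))

lemma apply_localToGlobal (τ : Kbar →ₐ[K] Ω) (g : Gal(Ω/Kv)) (x : Kbar) :
    τ (localToGlobal τ g x) = g (τ x) := by
  let _ : Algebra Kbar Ω := τ.toRingHom.toAlgebra
  have : IsScalarTower K Kbar Ω := IsScalarTower.of_algebraMap_eq' τ.comp_algebraMap.symm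
  exact AlgEquiv.restrictNormal_commutes (g.restrictScalars K) Kbar x

lemma continuous_localToGlobal (τ : Kbar →ₐ[K] Ω) :
    Continuous (localToGlobal τ : Gal(Ω/Kv) →* Gal(Kbar/K)) := by
  refine continuous_of_continuousAt_one _ ?_
  rw [ContinuousAt, map_one]
  intro U hU
  obtain ⟨E, hE, hEU⟩ := (krullTopology_mem_nhds_one_iff K Kbar U).1 hU
  rw [Filter.mem_map, krullTopology_mem_nhds_one_iff]
  have hEfg : E.FG :=
    IntermediateField.fg_of_fg_toSubalgebra E (Subalgebra.fg_of_fg_toSubmodule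
      (Module.Finite.iff_fg.1 (inferInstanceAs (Module.Finite K E))))
  obtain ⟨s, hs⟩ := hEfg
  refine ⟨IntermediateField.adjoin Kv (τ '' s), ?_, fun g hg => hEU ?_⟩
  · have : Finite (τ '' (s : Set Kbar)) := (s.finite_toSet.image τ).to_subtype
    refine IntermediateField.finiteDimensional_adjoin ?_
    rintro _ ⟨x, -, rfl⟩
    have h1 : IsIntegral K (τ x) := (Normal.isIntegral (F := K) inferInstance x).map τ
    exact h1.tower_top
  · change localToGlobal τ g ∈ E.fixingSubgroup
    rintro ⟨x, hx⟩
    change localToGlobal τ g x = x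
    rw [← hs] at hx
    induction hx using IntermediateField.adjoin_induction with
    | mem x hx =>
      apply τ.injective
      refine (apply_localToGlobal τ g x).trans ?_
      exact hg ⟨τ x, IntermediateField.subset_adjoin _ _ ⟨x, hx, rfl⟩⟩
    | algebraMap x => exact AlgEquiv.commutes _ x
    | add x y _ _ hx hy => rw [map_add, hx, hy]
    | inv x _ hx => rw [map_inv₀, hx]
    | mul x y _ _ hx hy => rw [map_mul, hx, hy]

/-- The compositum `Kv · τ(F)` inside `Ω`. -/
abbrev localField (Kv : Type u) [Field Kv] [Algebra K Kv] [Algebra Kv Ω] [IsScalarTower K Kv Ω]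
    (τ : Kbar →ₐ[K] Ω) (F : IntermediateField K Kbar) : IntermediateField Kv Ω :=
  IntermediateField.adjoin Kv (τ '' F)

/-- Restriction `Gal(Ω / Kv · τ(F)) → Gal(Kbar/F)` along `τ`. -/
noncomputable def localToGlobalOver (Kv : Type u) [Field Kv] [Algebra K Kv] [Algebra Kv Ω]
    [IsScalarTower K Kv Ω] (τ : Kbar →ₐ[K] Ω) (F : IntermediateField K Kbar) :
    (localField Kv τ F).fixingSubgroup →* F.fixingSubgroup :=
  ((localToGlobal τ).comp (localField Kv τ F).fixingSubgroup.subtype).codRestrict _ (by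
    rintro g ⟨x, hx⟩
    apply τ.injective
    refine (apply_localToGlobal τ g.1 x).trans ?_
    exact g.2 ⟨τ x, IntermediateField.subset_adjoin _ _ ⟨x, hx, rfl⟩⟩)

lemma continuous_localToGlobalOver (τ : Kbar →ₐ[K] Ω) (F : IntermediateField K Kbar) :
    Continuous (localToGlobalOver Kv τ F) :=
  ((continuous_localToGlobal τ).comp continuous_subtype_val).subtype_mk _

variable {A : Type*} [AddCommGroup A]

/-- `H¹(F_w, A)` where `F_w = Kv · τ(F)` and the `Gal(Kbar/K)`-module `A` is regarded as a
`Gal(Ω/F_w)`-module through `τ`. -/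
abbrev localH1 (Kv : Type u) [Field Kv] [Algebra K Kv] [Algebra Kv Ω]
    [IsScalarTower K Kv Ω] (ρ : Gal(Kbar/K) →* AddMonoid.End A) (τ : Kbar →ₐ[K] Ω)
    (F : IntermediateField K Kbar) : Type _ :=
  contH1 ((ρ.comp F.fixingSubgroup.subtype).comp (localToGlobalOver Kv τ F))

/-- The localization map `H¹(F, A) → H¹(F_w, A)`, `F_w = Kv · τ(F)`. -/
noncomputable def localization (Kv : Type u) [Field Kv] [Algebra K Kv] [Algebra Kv Ω]
    [IsScalarTower K Kv Ω] (ρ : Gal(Kbar/K) →* AddMonoid.End A) (τ : Kbar →ₐ[K] Ω)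
    (F : IntermediateField K Kbar) : galH1 ρ F →+ localH1 Kv ρ τ F :=
  contH1Map _ _ (localToGlobalOver Kv τ F) (continuous_localToGlobalOver τ F)
    (AddMonoidHom.id A) (fun _ _ => rfl)

end Local

section Selmer

variable {K : Type u} [Field K] [NumberField K] {Kbar : Type v} [Field Kbar] [Algebra K Kbar]
  [Normal K Kbar] {A : Type w} [AddCommGroup A]

/-- The `S`-imprimitive strict Selmer group of the `Gal(Kbar/K)`-module `A` over `F`: the kernel of
`H¹(F, A) → ∏_{v ∉ S} H¹(F ⊗ K_v, A)`, `v` running over the finite places of `K` outside `S`.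
The places `w` of `F` above `v` are the ones induced by the `K`-embeddings `τ` of `Kbar` in an
algebraic closure of `K_v`, with `F_w = K_v · τ(F)`. So a class lies in the kernel exactly when
it dies in `H¹(F_w, A)` for all `v ∉ S` and all `τ`. -/
noncomputable def imprimitiveSelmer (ρ : Gal(Kbar/K) →* AddMonoid.End A)
    (S : Finset (HeightOneSpectrum (𝓞 K))) (F : IntermediateField K Kbar) :
    AddSubgroup (galH1 ρ F) :=
  ⨅ (v : HeightOneSpectrum (𝓞 K)) (_ : v ∉ S)
    (τ : Kbar →ₐ[K] AlgebraicClosure (v.adicCompletion K)),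
    (localization (v.adicCompletion K) ρ τ F).ker

end Selmer

section Elliptic

instance isElliptic_baseChange {R S : Type*} [CommRing R] [CommRing S] [Algebra R S]
    (V : WeierstrassCurve R) [V.IsElliptic] : (V.baseChange S).IsElliptic :=
  inferInstanceAs (V.map (algebraMap R S)).IsElliptic

lemma infinite_point {K : Type u} [Field K] (W : WeierstrassCurve.Affine K) (Kbar : Type v)
    [Field Kbar] [Algebra K Kbar] [IsAlgClosed Kbar] [W.IsElliptic] :
    Infinite (W.baseChange Kbar).Point := by
  have key : ∀ x : Kbar, ∃ y : Kbar, (W.baseChange Kbar).Nonsingular x y := by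
    intro x
    set V := W.baseChange Kbar
    let q : Polynomial Kbar := Polynomial.C 1 * Polynomial.X ^ 2
      + Polynomial.C (V.a₁ * x + V.a₃) * Polynomial.X
      + Polynomial.C (-(x ^ 3 + V.a₂ * x ^ 2 + V.a₄ * x + V.a₆))
    have hq : q.degree = 2 := Polynomial.degree_quadratic one_ne_zero
    obtain ⟨y, hy⟩ := IsAlgClosed.exists_root q (by rw [hq]; decide)
    refine ⟨y, WeierstrassCurve.Affine.equation_iff_nonsingular.1 ?_⟩
    rw [WeierstrassCurve.Affine.equation_iff]
    simp only [Polynomial.IsRoot, q, Polynomial.eval_add, Polynomial.eval_mul, Polynomial.eval_C,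
      Polynomial.eval_pow, Polynomial.eval_X] at hy
    linear_combination hy
  choose y hy using key
  have : Infinite Kbar := IsAlgClosed.instInfinite
  refine Infinite.of_injective (fun x => WeierstrassCurve.Affine.Point.some x (y x) (hy x)) ?_
  intro a b hab
  simpa using (WeierstrassCurve.Affine.Point.some.inj hab).1

variable {K : Type u} [Field K] (W : WeierstrassCurve.Affine K) (Kbar : Type v) [Field Kbar]
  [Algebra K Kbar] [DecidableEq Kbar]

/-- The action of `Gal(Kbar/K)` on `W(Kbar)`. -/
noncomputable def galPoint : Gal(Kbar/K) →* AddMonoid.End (W.baseChange Kbar).Point where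
  toFun σ := WeierstrassCurve.Affine.Point.map (W' := W) (σ : Kbar →ₐ[K] Kbar)
  map_one' := by
    ext P
    cases P <;> rfl
  map_mul' σ τ := by
    ext P
    cases P <;> rfl

variable {W Kbar} in
/-- At the point `P = (x, y)` the map `φ` is given by `(x, y) ↦ (f/d, g/d)`, and `d(x, y) ≠ 0`. -/
def IsGivenBy (f g d : MvPolynomial (Fin 2) K) (φ : AddMonoid.End (W.baseChange Kbar).Point)
    (P : (W.baseChange Kbar).Point) : Prop :=
  ∃ (x y : Kbar) (h : (W.baseChange Kbar).Nonsingular x y), P = .some x y h ∧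
    MvPolynomial.aeval ![x, y] d ≠ 0 ∧
    ∃ h' : (W.baseChange Kbar).Nonsingular
        (MvPolynomial.aeval ![x, y] f / MvPolynomial.aeval ![x, y] d)
        (MvPolynomial.aeval ![x, y] g / MvPolynomial.aeval ![x, y] d),
      φ P = .some _ _ h'

/-- `φ` is an endomorphism of the elliptic curve `W` defined over `K` (`Kbar` is an algebraic
closure of `K`): it is an endomorphism of the group `W(Kbar)` that is zero or is given, away from
finitely many points, by rational functions with coefficients in `K`. -/
def IsEndomorphism (φ : AddMonoid.End (W.baseChange Kbar).Point) : Prop :=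
  φ = 0 ∨ ∃ f g d : MvPolynomial (Fin 2) K, {P | ¬ IsGivenBy f g d φ P}.Finite

/-- Complex multiplication by the ring of integers of `K`: an isomorphism of `𝓞 K` with the ring
of endomorphisms of `W` over `K`. -/
structure CMByIntegers where
  /-- The endomorphism `[a]` attached to `a`. -/
  toEnd : 𝓞 K →+* AddMonoid.End (W.baseChange Kbar).Point
  injective : Function.Injective toEnd
  mem_range_iff : ∀ φ, φ ∈ toEnd.range ↔ IsEndomorphism W Kbar φ

/-- Endomorphisms over `K` commute with the action of `Gal(Kbar/K)`. -/
lemma IsEndomorphism.commute [IsAlgClosure K Kbar] [W.IsElliptic]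
    {φ : AddMonoid.End (W.baseChange Kbar).Point} (hφ : IsEndomorphism W Kbar φ)
    (σ : Gal(Kbar/K)) (P : (W.baseChange Kbar).Point) :
    φ (galPoint W Kbar σ P) = galPoint W Kbar σ (φ P) := by
  obtain rfl | ⟨f, g, d, hfin⟩ := hφ
  · exact (map_zero (galPoint W Kbar σ)).symm
  have : IsAlgClosed Kbar := IsAlgClosure.isAlgClosed K
  have := infinite_point W Kbar
  have hinj : Function.Injective (galPoint W Kbar σ) :=
    WeierstrassCurve.Affine.Point.map_injective (W' := W) (σ : Kbar →ₐ[K] Kbar)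
  have haev : ∀ (q : MvPolynomial (Fin 2) K) (x y : Kbar),
      MvPolynomial.aeval ![σ x, σ y] q = σ (MvPolynomial.aeval ![x, y] q) := by
    intro q x y
    have h1 : (![σ x, σ y] : Fin 2 → Kbar) = fun i => (σ : Kbar →ₐ[K] Kbar) (![x, y] i) := by
      funext i
      fin_cases i <;> rfl
    rw [h1, ← MvPolynomial.comp_aeval_apply]
    rfl
  let H : AddSubgroup (W.baseChange Kbar).Point :=
    AddMonoidHom.eqLocus ((φ : _ →+ _).comp (galPoint W Kbar σ : _ →+ _))
      ((galPoint W Kbar σ : _ →+ _).comp (φ : _ →+ _))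
  have hH : ((H : Set (W.baseChange Kbar).Point)ᶜ).Finite := by
    refine (hfin.union (hfin.preimage hinj.injOn)).subset ?_
    intro Q hQ
    by_contra hcon
    apply hQ
    simp only [Set.mem_union, Set.mem_ofPred_eq, Set.mem_preimage, not_or, not_not] at hcon
    obtain ⟨⟨x, y, h, rfl, hd, h', hv⟩, ⟨x', y', h₂, he, hd', h₂', hv'⟩⟩ := hcon
    change φ (galPoint W Kbar σ _) = galPoint W Kbar σ (φ _)
    rw [hv', hv]
    obtain ⟨rfl, rfl⟩ : σ x = x' ∧ σ y = y' := WeierstrassCurve.Affine.Point.some.inj he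
    change _ = WeierstrassCurve.Affine.Point.some (σ _) (σ _) _
    simp only [haev, map_div₀]
  by_contra hP
  have hP' : P ∉ H := hP
  have hHinf : (H : Set (W.baseChange Kbar).Point).Infinite := by
    intro hHfin
    exact Set.infinite_univ (by simpa using hHfin.union hH)
  refine (hHinf.image (f := fun Q => P + Q) (fun a _ b _ hab => add_left_cancel hab)) (hH.subset ?_)
  rintro _ ⟨Q, hQ, rfl⟩ hmem
  exact hP' ((H.add_mem_cancel_right hQ).1 hmem)

end Elliptic

namespace CMByIntegers

variable {K : Type u} [Field K] {W : WeierstrassCurve.Affine K} {Kbar : Type v} [Field Kbar]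
  [Algebra K Kbar] [DecidableEq Kbar] (ι : CMByIntegers W Kbar)

/-- `E[𝔭^∞]`: the points of `E(Kbar)` that are killed by some power of the ideal `𝔭`. -/
def primaryTorsion (𝔭 : HeightOneSpectrum (𝓞 K)) : AddSubgroup (W.baseChange Kbar).Point where
  carrier := {P | ∃ n : ℕ, ∀ a ∈ 𝔭.asIdeal ^ n, ι.toEnd a P = 0}
  zero_mem' := ⟨0, fun a _ => map_zero _⟩
  add_mem' := by
    rintro P Q ⟨m, hm⟩ ⟨n, hn⟩
    refine ⟨max m n, fun a ha => ?_⟩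
    rw [map_add, hm a (Ideal.pow_le_pow_right (le_max_left _ _) ha),
      hn a (Ideal.pow_le_pow_right (le_max_right _ _) ha), add_zero]
  neg_mem' := by
    rintro P ⟨m, hm⟩
    exact ⟨m, fun a ha => by rw [map_neg, hm a ha, neg_zero]⟩

section

variable [IsAlgClosure K Kbar] [W.IsElliptic]

lemma galPoint_mem (𝔭 : HeightOneSpectrum (𝓞 K)) (σ : Gal(Kbar/K))
    {P : (W.baseChange Kbar).Point} (hP : P ∈ ι.primaryTorsion 𝔭) :
    galPoint W Kbar σ P ∈ ι.primaryTorsion 𝔭 := by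
  obtain ⟨n, hn⟩ := hP
  refine ⟨n, fun a ha => ?_⟩
  rw [((ι.mem_range_iff _).1 ⟨a, rfl⟩).commute, hn a ha, map_zero]

/-- The action of `Gal(Kbar/K)` on `E[𝔭^∞]`. -/
noncomputable def galoisRep (𝔭 : HeightOneSpectrum (𝓞 K)) :
    Gal(Kbar/K) →* AddMonoid.End (ι.primaryTorsion 𝔭) where
  toFun σ := ((galPoint W Kbar σ : _ →+ _).comp (ι.primaryTorsion 𝔭).subtype).codRestrict _
    (fun P => ι.galPoint_mem 𝔭 σ P.2)
  map_one' := by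
    ext P
    exact congrArg (fun u : AddMonoid.End (W.baseChange Kbar).Point => u P) (map_one (galPoint W Kbar))
  map_mul' σ τ := by
    ext P
    exact congrArg (fun u : AddMonoid.End (W.baseChange Kbar).Point => u P)
      (map_mul (galPoint W Kbar) σ τ)

end

/-- The field `L(E[𝔭^∞])`, generated over `L` by the coordinates of the points of `E[𝔭^∞]`. -/
def divisionField (𝔭 : HeightOneSpectrum (𝓞 K)) (L : IntermediateField K Kbar) :
    IntermediateField K Kbar :=
  L ⊔ IntermediateField.adjoin K {z | ∃ (x y : Kbar) (h : (W.baseChange Kbar).Nonsingular x y),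
    .some x y h ∈ ι.primaryTorsion 𝔭 ∧ (z = x ∨ z = y)}

lemma le_divisionField (𝔭 : HeightOneSpectrum (𝓞 K)) (L : IntermediateField K Kbar) :
    L ≤ ι.divisionField 𝔭 L := le_sup_left

instance isGalois_divisionField [IsAlgClosure K Kbar] [W.IsElliptic] [IsGalois K Kbar]
    (𝔭 : HeightOneSpectrum (𝓞 K)) (L : IntermediateField K Kbar) [IsGalois K L] :
    IsGalois K (ι.divisionField 𝔭 L) := by
  have hN : Normal K (ι.divisionField 𝔭 L) := by
    rw [IntermediateField.normal_iff_forall_map_le']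
    intro σ
    rw [divisionField, IntermediateField.map_sup]
    refine sup_le_sup (IntermediateField.normal_iff_forall_map_le'.1 inferInstance σ) ?_
    rw [IntermediateField.adjoin_map]
    refine IntermediateField.adjoin.mono _ _ _ ?_
    rintro _ ⟨z, ⟨x, y, h, hmem, hz⟩, rfl⟩
    refine ⟨σ x, σ y, _, ι.galPoint_mem 𝔭 σ hmem, ?_⟩
    rcases hz with rfl | rfl
    · exact Or.inl rfl
    · exact Or.inr rfl
  exact {}

end CMByIntegers

/-- The subgroup `Sel_S(F', A)^{Gal(F'/L)}` of the elements of the Selmer group over `F'` that are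
fixed by `Gal(F'/L)`, where `F'/K` is Galois and `L ≤ F'`; `Gal(F'/L)` acts through lifts to
`Gal(Kbar/L)`. -/
noncomputable def selmerInvariants {K : Type u} [Field K] [NumberField K] {Kbar : Type v}
    [Field Kbar] [Algebra K Kbar] [IsGalois K Kbar] {A : Type w} [AddCommGroup A]
    (ρ : Gal(Kbar/K) →* AddMonoid.End A) (S : Finset (HeightOneSpectrum (𝓞 K)))
    (L F' : IntermediateField K Kbar) [IsGalois K F'] : AddSubgroup (galH1 ρ F') :=
  imprimitiveSelmer ρ S F' ⊓ ⨅ σ ∈ L.fixingSubgroup, (galConj ρ F' σ - AddMonoidHom.id _).ker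

/-!
The group `A = E[𝔭^∞]` is isomorphic to `ℚ_p/ℤ_p`. The only substantial point is that `A[p]` has
order at most `p`. On `x`-coordinates the endomorphism `[a]` is a rational function, and the
formulas for the sum and the product of `x(P + Q)` and `x(P - Q)` give one half of the
parallelogram law for its degree. So the degree is at most a constant times `N(a)`, and so is the
order of the kernel of `[a]`. Comparing the kernels of the powers of `a` removes the constant.
Now apply this bound to a generator of a principal power of `𝔭`.

Let `N` be the subgroup of `Gal(Kbar/L)` acting trivially on `A`, so that `N = Gal(Kbar/L^𝔭)`.
The group `Γ = Gal(Kbar/L)/N` is a closed subgroup of `Aut A = ℤ_p^×`, and `p` is odd, so `Γ` is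
topologically generated by one element `g`. Since `g - 1` is zero or surjective on `A`, every
cocycle of `Γ` is a coboundary, so restriction to `N` is injective on `H¹`. The same argument
applies to the decomposition groups, so a class over `L` satisfies the Selmer conditions as soon
as its restriction does.

For surjectivity, a class over `L^𝔭` fixed by `Γ` is a homomorphism `f : N → A` that is
equivariant for conjugation. Its kernel contains the intersection of `N` with an open normal
subgroup, and a lift of `g`, together with a small enough open subgroup, generates an open
subgroup `H` with `N H` equal to everything and `f` zero on `N ∩ H`. So `f` extends to a cocycle
that vanishes on `H`.
-/

/-- An abelian group is `p`-quasi-cyclic if it is `p`-primary, `p`-divisible and its `p`-torsion is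
cyclic. It is then zero or isomorphic to `ℚ_p/ℤ_p`. -/
structure IsQuasiCyclic (p : ℕ) (A : Type*) [AddCommGroup A] : Prop where
  exists_pow_smul_eq_zero : ∀ a : A, ∃ n : ℕ, p ^ n • a = 0
  exists_smul_eq : ∀ a : A, ∃ b : A, p • b = a
  exists_eq_smul : ∀ x y : A, p • x = 0 → x ≠ 0 → p • y = 0 → ∃ n : ℕ, y = n • x

lemma addOrderOf_pow_smul_eq_prime {p : ℕ} (hp : p.Prime) {A : Type*} [AddMonoid A] {a : A} {j : ℕ}
    (ha : addOrderOf a = p ^ (j + 1)) : addOrderOf (p ^ j • a) = p := by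
  rw [addOrderOf_nsmul_of_dvd (pow_ne_zero _ hp.ne_zero) (ha ▸ pow_dvd_pow p j.le_succ), ha,
    pow_succ, Nat.mul_div_cancel_left _ (pow_pos hp.pos j)]

namespace IsQuasiCyclic

variable {p : ℕ} {A : Type*} [AddCommGroup A]

lemma exists_addOrderOf_eq_prime_pow (hA : IsQuasiCyclic p A) (hp : p.Prime) (a : A) :
    ∃ m, addOrderOf a = p ^ m :=
  have := Fact.mk hp
  exists_addOrderOf_eq_prime_pow_iff.2 (hA.exists_pow_smul_eq_zero a)

lemma exists_pow_smul_eq (hA : IsQuasiCyclic p A) (m : ℕ) (a : A) : ∃ b : A, p ^ m • b = a := by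
  induction m generalizing a with
  | zero => exact ⟨a, by simp⟩
  | succ m ih =>
    obtain ⟨b, rfl⟩ := hA.exists_smul_eq a
    obtain ⟨c, rfl⟩ := ih b
    exact ⟨c, by rw [pow_succ', mul_smul]⟩

lemma exists_addOrderOf_eq (hA : IsQuasiCyclic p A) (hp : p.Prime) [Nontrivial A] (m : ℕ) :
    ∃ e : A, addOrderOf e = p ^ m := by
  have := Fact.mk hp
  obtain _ | m := m
  · exact ⟨0, by simp⟩
  obtain ⟨a, ha⟩ := exists_ne (0 : A)
  obtain ⟨j, hj⟩ := hA.exists_addOrderOf_eq_prime_pow hp a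
  obtain _ | j := j
  · exact absurd (AddMonoid.addOrderOf_eq_one_iff.1 hj) ha
  have hpj := addOrderOf_pow_smul_eq_prime hp hj
  obtain ⟨e, he⟩ := hA.exists_pow_smul_eq m (p ^ j • a)
  refine ⟨e, addOrderOf_eq_prime_pow (fun h => ?_) ?_⟩
  · rw [← he, h, addOrderOf_zero] at hpj
    exact hp.one_lt.ne hpj
  · rw [pow_succ', mul_smul, he, ← mul_smul, ← pow_succ', ← hj, addOrderOf_nsmul_eq_zero]

lemma exists_eq_nsmul (hA : IsQuasiCyclic p A) (hp : p.Prime) {m : ℕ} {e a : A}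
    (he : addOrderOf e = p ^ m) (ha : p ^ m • a = 0) : ∃ n : ℕ, a = n • e := by
  induction m generalizing e a with
  | zero => exact ⟨0, by simpa using ha⟩
  | succ m ih =>
    have hpm : p ^ m • e ≠ 0 := fun h =>
      (Nat.pow_lt_pow_right hp.one_lt m.lt_succ_self).not_ge
        (he ▸ addOrderOf_le_of_nsmul_eq_zero (pow_pos hp.pos m) h)
    have hpe : addOrderOf (p • e) = p ^ m := by
      rw [addOrderOf_nsmul_of_dvd hp.ne_zero (he ▸ dvd_pow_self p m.succ_ne_zero), he,
        pow_succ, Nat.mul_div_cancel _ hp.pos]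
    obtain ⟨n, hn⟩ := ih hpe (a := p • a) (by rwa [← mul_smul, ← pow_succ])
    obtain ⟨k, hk⟩ := hA.exists_eq_smul (p ^ m • e) (a - n • e)
      (by rw [← mul_smul, ← pow_succ', ← he, addOrderOf_nsmul_eq_zero]) hpm
      (by rw [smul_sub, hn, smul_comm, sub_self])
    exact ⟨n + k * p ^ m, by rw [add_smul, mul_smul, ← hk, add_sub_cancel]⟩

lemma exists_forall_eq_nsmul (hA : IsQuasiCyclic p A) (hp : p.Prime) (u : AddMonoid.End A)
    (m : ℕ) : ∃ n : ℕ, ∀ a, p ^ m • a = 0 → u a = n • a := by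
  cases subsingleton_or_nontrivial A
  · exact ⟨0, fun _ _ => Subsingleton.elim _ _⟩
  obtain ⟨e, he⟩ := hA.exists_addOrderOf_eq hp m
  have hue : p ^ m • u e = 0 := by rw [← map_nsmul, ← he, addOrderOf_nsmul_eq_zero, map_zero]
  obtain ⟨n, hn⟩ := hA.exists_eq_nsmul hp he hue
  refine ⟨n, fun a ha => ?_⟩
  obtain ⟨k, rfl⟩ := hA.exists_eq_nsmul hp he ha
  rw [map_nsmul, hn, smul_comm]

lemma range (hA : IsQuasiCyclic p A) {B : Type*} [AddCommGroup B] (hB : IsQuasiCyclic p B)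
    (u : A →+ B) : IsQuasiCyclic p u.range where
  exists_pow_smul_eq_zero b := (hB.exists_pow_smul_eq_zero b).imp fun _ h => Subtype.ext h
  exists_smul_eq := by
    rintro ⟨_, a, rfl⟩
    obtain ⟨b, rfl⟩ := hA.exists_smul_eq a
    exact ⟨⟨u b, b, rfl⟩, Subtype.ext (map_nsmul u p b).symm⟩
  exists_eq_smul x y hx hx0 hy :=
    (hB.exists_eq_smul x y (congrArg Subtype.val hx) (by simpa using hx0)
      (congrArg Subtype.val hy)).imp fun _ h => Subtype.ext h

lemma surjective_of_ne_zero (hA : IsQuasiCyclic p A) (hp : p.Prime) {B : Type*} [AddCommGroup B]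
    (hB : IsQuasiCyclic p B) {u : A →+ B} (hu : u ≠ 0) : Function.Surjective u := by
  intro b
  obtain ⟨a, ha⟩ := DFunLike.ne_iff.1 hu
  have : Nontrivial u.range := ⟨⟨u a, a, rfl⟩, 0, fun h => ha (congrArg Subtype.val h)⟩
  obtain ⟨m, hm⟩ := hB.exists_pow_smul_eq_zero b
  obtain ⟨c, hc⟩ := (hA.range hB u).exists_addOrderOf_eq hp m
  obtain ⟨e, he⟩ := c.2
  rw [← AddSubgroup.addOrderOf_coe, ← he] at hc
  obtain ⟨n, rfl⟩ := hB.exists_eq_nsmul hp hc hm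
  exact ⟨n • e, map_nsmul _ _ _⟩

end IsQuasiCyclic

section TorsionKer

variable {p : ℕ} {Γ A : Type*} [Group Γ] [AddCommGroup A]

lemma map_mul_apply (ρ : Γ →* AddMonoid.End A) (g h : Γ) (a : A) :
    ρ (g * h) a = ρ g (ρ h a) := by
  rw [map_mul, AddMonoid.End.coe_mul, Function.comp_apply]

lemma map_one_apply (ρ : Γ →* AddMonoid.End A) (a : A) : ρ 1 a = a := by
  rw [map_one, AddMonoid.End.coe_one, id]

lemma map_inv_apply_self (ρ : Γ →* AddMonoid.End A) (g : Γ) (a : A) : ρ g⁻¹ (ρ g a) = a := by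
  rw [← map_mul_apply, inv_mul_cancel, map_one_apply]

lemma mem_ker_iff_forall_apply {ρ : Γ →* AddMonoid.End A} {g : Γ} :
    g ∈ ρ.ker ↔ ∀ a, ρ g a = a :=
  MonoidHom.mem_ker.trans DFunLike.ext_iff

/-- The subgroup of the elements acting trivially on the `p ^ m`-torsion. -/
def torsionKer (p : ℕ) (ρ : Γ →* AddMonoid.End A) (m : ℕ) : Subgroup Γ where
  carrier := {g | ∀ a, p ^ m • a = 0 → ρ g a = a}
  one_mem' a _ := map_one_apply ρ a
  mul_mem' {g h} hg hh a ha := by rw [map_mul_apply, hh a ha, hg a ha]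
  inv_mem' {g} hg a ha := by rw [← congrArg (ρ g⁻¹) (hg a ha), map_inv_apply_self]

variable {ρ : Γ →* AddMonoid.End A}

instance torsionKer_normal (p : ℕ) (ρ : Γ →* AddMonoid.End A) (m : ℕ) :
    (torsionKer p ρ m).Normal where
  conj_mem n hn g a ha := by
    rw [map_mul_apply, map_mul_apply, hn _ (by rw [← map_nsmul, ha, map_zero]), ← map_mul_apply,
      mul_inv_cancel, map_one_apply]

lemma ker_le_torsionKer (p : ℕ) (ρ : Γ →* AddMonoid.End A) (m : ℕ) : ρ.ker ≤ torsionKer p ρ m :=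
  fun _ hg a _ => mem_ker_iff_forall_apply.1 hg a

lemma torsionKer_antitone (p : ℕ) (ρ : Γ →* AddMonoid.End A) : Antitone (torsionKer p ρ) :=
  fun _ _ h _ hg a ha =>
    hg a (addOrderOf_dvd_iff_nsmul_eq_zero.1
      ((addOrderOf_dvd_of_nsmul_eq_zero ha).trans (pow_dvd_pow p h)))

lemma exists_notMem_torsionKer (hA : IsQuasiCyclic p A) {g : Γ} (hg : g ∉ ρ.ker) :
    ∃ m, g ∉ torsionKer p ρ m := by
  contrapose! hg
  refine mem_ker_iff_forall_apply.2 fun a => ?_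
  obtain ⟨m, hm⟩ := hA.exists_pow_smul_eq_zero a
  exact hg m a hm

lemma ker_eq_iInf_torsionKer (hA : IsQuasiCyclic p A) (ρ : Γ →* AddMonoid.End A) :
    ρ.ker = ⨅ m, torsionKer p ρ m := by
  refine le_antisymm (le_iInf (ker_le_torsionKer p ρ)) fun g hg => by_contra fun hker => ?_
  obtain ⟨m, hm⟩ := exists_notMem_torsionKer hA hker
  exact hm (Subgroup.mem_iInf.1 hg m)

lemma mem_torsionKer_iff_apply_eq (hA : IsQuasiCyclic p A) (hp : p.Prime) {m : ℕ} {e : A}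
    (he : addOrderOf e = p ^ m) {g : Γ} : g ∈ torsionKer p ρ m ↔ ρ g e = e := by
  refine ⟨fun h => h e (by rw [← he, addOrderOf_nsmul_eq_zero]), fun h a ha => ?_⟩
  obtain ⟨n, rfl⟩ := hA.exists_eq_nsmul hp he ha
  rw [map_nsmul, h]

lemma exists_ker_eq_torsionKer (hA : IsQuasiCyclic p A) (hp : p.Prime)
    (ρ : Γ →* AddMonoid.End A) (m : ℕ) : ∃ χ : Γ →* (ZMod (p ^ m))ˣ, χ.ker = torsionKer p ρ m := by
  cases subsingleton_or_nontrivial A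
  · exact ⟨1, le_antisymm (fun _ _ _ _ => Subsingleton.elim _ _) fun _ _ => rfl⟩
  obtain ⟨e, he⟩ := hA.exists_addOrderOf_eq hp m
  have hpe (g : Γ) : p ^ m • ρ g e = 0 := by
    rw [← map_nsmul, ← he, addOrderOf_nsmul_eq_zero, map_zero]
  choose n hn using fun g => hA.exists_eq_nsmul hp he (hpe g)
  have nsmul_eq_iff (i j : ℕ) : i • e = j • e ↔ (i : ZMod (p ^ m)) = j := by
    rw [nsmul_eq_nsmul_iff_modEq, he, ZMod.natCast_eq_natCast_iff]
  let χ : Γ →* ZMod (p ^ m) :=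
    { toFun := fun g => n g
      map_one' := by
        rw [← Nat.cast_one, ← nsmul_eq_iff, ← hn, map_one_apply, one_smul]
      map_mul' := fun g h => by
        rw [← Nat.cast_mul, ← nsmul_eq_iff, ← hn, map_mul_apply, hn h, map_nsmul, hn g, mul_comm,
          mul_smul] }
  refine ⟨χ.toHomUnits, ?_⟩
  ext g
  rw [mem_torsionKer_iff_apply_eq hA hp he, hn g, MonoidHom.mem_ker, Units.ext_iff]
  conv_rhs => rhs; rw [← one_smul ℕ e]
  rw [nsmul_eq_iff, Nat.cast_one]
  rfl

lemma isCyclic_quotient_torsionKer (hA : IsQuasiCyclic p A) (hp : p.Prime) (hp2 : p ≠ 2)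
    (ρ : Γ →* AddMonoid.End A) (m : ℕ) : IsCyclic (Γ ⧸ torsionKer p ρ m) := by
  obtain ⟨χ, hχ⟩ := exists_ker_eq_torsionKer hA hp ρ m
  have := ZMod.isCyclic_units_of_prime_pow p hp hp2 m
  have := isCyclic_of_injective _ (QuotientGroup.kerLift_injective χ)
  exact (QuotientGroup.quotientMulEquivOfEq hχ).isCyclic.1 this

lemma eq_zero_of_apply_eq_self (hA : IsQuasiCyclic p A) (hp : p.Prime) {g : Γ}
    (hg : g ∉ torsionKer p ρ 1) {a : A} (ha : ρ g a = a) : a = 0 := by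
  obtain ⟨j, hj⟩ := hA.exists_addOrderOf_eq_prime_pow hp a
  obtain _ | j := j
  · exact AddMonoid.addOrderOf_eq_one_iff.1 hj
  have hpj := (addOrderOf_pow_smul_eq_prime hp hj).trans (pow_one p).symm
  exact absurd ((mem_torsionKer_iff_apply_eq hA hp hpj).2 (by rw [map_nsmul, ha])) hg

lemma pow_dvd_of_zpow_mem_torsionKer (hA : IsQuasiCyclic p A) (hp : p.Prime) (hp2 : p ≠ 2)
    {g : Γ} (hg1 : g ∈ torsionKer p ρ 1) {k : ℕ} (hg : g ∉ torsionKer p ρ (k + 1)) {j : ℕ} {t : ℤ}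
    (ht : g ^ t ∈ torsionKer p ρ (k + j)) : (p : ℤ) ^ j ∣ t := by
  wlog hnat : ∃ i : ℕ, t = i generalizing t
  · obtain ⟨i, rfl | rfl⟩ := t.eq_nat_or_neg
    · exact absurd ⟨i, rfl⟩ hnat
    · exact (this (by simpa using ht) ⟨i, rfl⟩).neg_right
  obtain ⟨t, rfl⟩ := hnat
  rw [zpow_natCast] at ht
  have hA0 : Nontrivial A := not_subsingleton_iff_nontrivial.1 fun h =>
    hg fun _ _ => Subsingleton.elim _ _
  obtain ⟨n, hn⟩ := hA.exists_forall_eq_nsmul hp (ρ g) (k + j + 1)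
  have apply_pow (i : ℕ) {a : A} (ha : p ^ (k + j + 1) • a = 0) : ρ (g ^ i) a = n ^ i • a := by
    induction i with
    | zero => rw [pow_zero, map_one_apply, pow_zero, one_smul]
    | succ i ih => rw [pow_succ', map_mul_apply, ih, map_nsmul, hn a ha, pow_succ, mul_smul]
  have mem_iff {l : ℕ} (hl : l ≤ k + j + 1) (i : ℕ) :
      g ^ i ∈ torsionKer p ρ l ↔ (p : ℤ) ^ l ∣ (n : ℤ) ^ i - 1 := by
    obtain ⟨e, he⟩ := hA.exists_addOrderOf_eq hp l
    have hpe : p ^ (k + j + 1) • e = 0 :=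
      addOrderOf_dvd_iff_nsmul_eq_zero.1 (he ▸ pow_dvd_pow p hl)
    rw [mem_torsionKer_iff_apply_eq hA hp he, apply_pow i hpe, ← Nat.cast_pow p, ← he,
      addOrderOf_dvd_iff_zsmul_eq_zero, sub_smul, one_smul, sub_eq_zero, ← Nat.cast_pow,
      natCast_zsmul]
  have hdvd : (p : ℤ) ∣ n - 1 := by
    simpa only [pow_one] using (mem_iff (l := 1) (by omega) 1).1 ((pow_one g).symm ▸ hg1)
  have hndvd : ¬ (p : ℤ) ^ (k + 1) ∣ n - 1 := fun h =>
    hg (pow_one g ▸ (mem_iff (by omega) 1).2 (by rwa [pow_one]))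
  have hpn : ¬ (p : ℤ) ∣ n := fun h =>
    (Nat.prime_iff_prime_int.1 hp).not_dvd_one ((dvd_sub_right h).1 hdvd)
  have lte := Int.emultiplicity_pow_sub_pow hp (hp.odd_of_ne_two hp2) (y := 1) hdvd hpn t
  have hle := pow_dvd_iff_le_emultiplicity.1 ((mem_iff (by omega) t).1 ht)
  rw [one_pow] at lte
  rw [lte, Nat.cast_add] at hle
  have hk : emultiplicity (p : ℤ) (n - 1) ≤ k :=
    ENat.lt_natCast_add_one_iff.1 (emultiplicity_lt_iff_not_dvd.2 hndvd)
  exact_mod_cast pow_dvd_iff_le_emultiplicity.2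
    ((ENat.add_le_add_iff_left (ENat.natCast_ne_top k)).1 (hle.trans (add_le_add_left hk _)))

end TorsionKer

section ContinuousAction

open scoped Topology

variable {p : ℕ} {Γ A : Type*} [Group Γ] [AddCommGroup A] {ρ : Γ →* AddMonoid.End A}

/-- An element `g` generates `Γ` topologically modulo a subgroup `N` if no proper open subgroup
contains both `N` and `g`. -/
def IsTopologicalGeneratorMod [TopologicalSpace Γ] (N : Subgroup Γ) (g : Γ) : Prop :=
  ∀ U : Subgroup Γ, IsOpen (U : Set Γ) → N ≤ U → g ∈ U → U = ⊤

lemma cocycle_map_one {F : Γ → A} (hF : ∀ g h, F (g * h) = F g + ρ g (F h)) : F 1 = 0 := by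
  simpa [map_one_apply] using hF 1 1

/-- The elements at which a cocycle vanishes. -/
def cocycleKer {F : Γ → A} (hF : ∀ g h, F (g * h) = F g + ρ g (F h)) : Subgroup Γ where
  carrier := {g | F g = 0}
  one_mem' := cocycle_map_one hF
  mul_mem' {g h} (hg : F g = 0) (hh : F h = 0) := by
    change F (g * h) = 0
    rw [hF, hg, hh, map_zero, add_zero]
  inv_mem' {g} (hg : F g = 0) := by
    have h : ρ g (F g⁻¹) = 0 := by
      rw [← zero_add (ρ g (F g⁻¹)), ← hg, ← hF, mul_inv_cancel, cocycle_map_one hF, hg]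
    change F g⁻¹ = 0
    rw [← map_inv_apply_self ρ g (F g⁻¹), h, map_zero]

variable [TopologicalSpace Γ]

lemma mem_contZ1_of_isOpen [IsTopologicalGroup Γ] {F : Γ → A}
    (hF : ∀ g h, F (g * h) = F g + ρ g (F h)) {U : Subgroup Γ} (hU : IsOpen (U : Set Γ))
    (h0 : ∀ h ∈ U, F h = 0) : F ∈ contZ1 ρ := by
  refine ⟨(IsLocallyConstant.iff_eventually_eq F).2 fun x => ?_, hF⟩
  have hx : Filter.Tendsto (x⁻¹ * ·) (𝓝 x) (𝓝 1) := by
    simpa using (continuous_const_mul x⁻¹).tendsto x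
  filter_upwards [hx (hU.mem_nhds U.one_mem)] with y hy
  rw [← mul_inv_cancel_left x y, hF, h0 _ hy, map_zero, add_zero]

lemma coboundary_mem_contZ1 [IsTopologicalGroup Γ] {a : A} (ha : IsOpen {g | ρ g a = a}) :
    (fun g => ρ g a - a) ∈ contZ1 ρ := by
  have hcocycle (g h : Γ) : ρ (g * h) a - a = ρ g a - a + ρ g (ρ h a - a) := by
    rw [map_mul_apply, map_sub]
    abel
  have hset : {g | ρ g a = a} = cocycleKer (F := fun g => ρ g a - a) hcocycle :=
    Set.ext fun g => (sub_eq_zero (a := ρ g a)).symm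
  exact mem_contZ1_of_isOpen hcocycle (hset ▸ ha) fun _ h => h

lemma IsTopologicalGeneratorMod.cocycle_eq_zero {N : Subgroup Γ} {g : Γ}
    (hg : IsTopologicalGeneratorMod N g) {F : Γ → A} (hF : F ∈ contZ1 ρ)
    (hN : ∀ n ∈ N, F n = 0) (hFg : F g = 0) (h : Γ) : F h = 0 :=
  (Subgroup.eq_top_iff' _).1 (hg (cocycleKer hF.2) (hF.1 {0}) hN hFg) h

lemma isOpen_torsionKer (hA : IsQuasiCyclic p A) (hp : p.Prime) (hρ : ∀ a, IsOpen {g | ρ g a = a})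
    (m : ℕ) : IsOpen (torsionKer p ρ m : Set Γ) := by
  cases subsingleton_or_nontrivial A
  · convert isOpen_univ
    exact Set.eq_univ_of_forall fun _ _ _ => Subsingleton.elim _ _
  obtain ⟨e, he⟩ := hA.exists_addOrderOf_eq hp m
  convert hρ e using 1
  ext g
  exact mem_torsionKer_iff_apply_eq hA hp he

variable [IsTopologicalGroup Γ]

lemma isClosed_torsionKer (hA : IsQuasiCyclic p A) (hp : p.Prime)
    (hρ : ∀ a, IsOpen {g | ρ g a = a}) (m : ℕ) : IsClosed (torsionKer p ρ m : Set Γ) :=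
  (torsionKer p ρ m).isClosed_of_isOpen (isOpen_torsionKer hA hp hρ m)

lemma isClosed_ker (hA : IsQuasiCyclic p A) (hp : p.Prime) (hρ : ∀ a, IsOpen {g | ρ g a = a}) :
    IsClosed (ρ.ker : Set Γ) := by
  rw [ker_eq_iInf_torsionKer hA, Subgroup.coe_iInf]
  exact isClosed_iInter (isClosed_torsionKer hA hp hρ)

variable [CompactSpace Γ]

lemma exists_torsionKer_subset (hA : IsQuasiCyclic p A) (hp : p.Prime)
    (hρ : ∀ a, IsOpen {g | ρ g a = a}) {U : Set Γ} (hU : IsOpen U) (hker : (ρ.ker : Set Γ) ⊆ U) :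
    ∃ m, (torsionKer p ρ m : Set Γ) ⊆ U := by
  have hclosed := isClosed_torsionKer hA hp hρ
  refine exists_subset_nhds_of_isCompact' (V := fun m => (torsionKer p ρ m : Set Γ))
    (directed_of_isDirected_le fun _ _ h => torsionKer_antitone p ρ h)
    (fun m => (hclosed m).isCompact) hclosed fun g hg => hU.mem_nhds (hker ?_)
  rwa [ker_eq_iInf_torsionKer hA, Subgroup.coe_iInf]

theorem exists_isTopologicalGeneratorMod_ker (hA : IsQuasiCyclic p A) (hp : p.Prime)
    (hp2 : p ≠ 2) (hρ : ∀ a, IsOpen {g | ρ g a = a}) :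
    ∃ g, IsTopologicalGeneratorMod ρ.ker g := by
  let generators (m : ℕ) : Set Γ :=
    {g | ∀ x : Γ ⧸ torsionKer p ρ m, x ∈ Subgroup.zpowers (g : Γ ⧸ torsionKer p ρ m)}
  have nonempty m : (generators m).Nonempty := by
    obtain ⟨q, hq⟩ := (isCyclic_quotient_torsionKer hA hp hp2 ρ m).exists_generator
    obtain ⟨g, rfl⟩ := QuotientGroup.mk_surjective q
    exact ⟨g, hq⟩
  have antitone m : generators (m + 1) ⊆ generators m := by
    intro g hg x
    obtain ⟨h, rfl⟩ := QuotientGroup.mk_surjective x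
    obtain ⟨i, hi⟩ := hg h
    exact ⟨i, QuotientGroup.eq.2 (torsionKer_antitone p ρ m.le_succ (QuotientGroup.eq.1 hi))⟩
  have closed m : IsClosed (generators m) := by
    have := QuotientGroup.discreteTopology (isOpen_torsionKer hA hp hρ m)
    exact (isClosed_discrete {q : Γ ⧸ torsionKer p ρ m | ∀ x, x ∈ Subgroup.zpowers q}).preimage
      continuous_quot_mk
  obtain ⟨g, hg⟩ := IsCompact.nonempty_iInter_of_sequence_nonempty_isCompact_isClosed generators
    antitone nonempty (closed 0).isCompact closed
  refine ⟨g, fun U hU hker hgU => (Subgroup.eq_top_iff' U).2 fun h => ?_⟩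
  obtain ⟨m, hm⟩ := exists_torsionKer_subset hA hp hρ hU hker
  obtain ⟨i, hi⟩ := Set.mem_iInter.1 hg m h
  rw [← mul_inv_cancel_left (g ^ i) h]
  exact mul_mem (zpow_mem hgU i) (hm (QuotientGroup.eq.1 hi))

theorem mem_contB1_of_forall_mem_ker (hA : IsQuasiCyclic p A) (hp : p.Prime) (hp2 : p ≠ 2)
    (hρ : ∀ a, IsOpen {g | ρ g a = a}) {f : Γ → A} (hf : f ∈ contZ1 ρ)
    (hker : ∀ n ∈ ρ.ker, f n = 0) : f ∈ contB1 ρ := by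
  obtain ⟨g, hg⟩ := exists_isTopologicalGeneratorMod_ker hA hp hp2 hρ
  obtain ⟨a, ha⟩ : ∃ a, ρ g a - a = f g := by
    by_cases h1 : ρ g = 1
    · refine ⟨0, ?_⟩
      rw [map_zero, sub_zero, hker g (MonoidHom.mem_ker.2 h1)]
    · exact hA.surjective_of_ne_zero hp hA (u := (ρ g - 1 : AddMonoid.End A))
        (sub_ne_zero.2 h1) (f g)
  have hF := sub_mem hf (coboundary_mem_contZ1 (hρ a))
  refine ⟨a, fun h => sub_eq_zero.1 (hg.cocycle_eq_zero hF (fun n hn => ?_) ?_ h)⟩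
  · simp only [Pi.sub_apply, hker n hn, mem_ker_iff_forall_apply.1 hn a, sub_self]
  · exact sub_eq_zero.2 ha.symm

end ContinuousAction

section CocycleExtension

variable {p : ℕ} {Γ A : Type*} [Group Γ] [TopologicalSpace Γ] [AddCommGroup A]
  {ρ : Γ →* AddMonoid.End A}

lemma map_mul_of_mem_contZ1_ker (f : contZ1 (ρ.comp ρ.ker.subtype)) (n n' : ρ.ker) :
    f.1 (n * n') = f.1 n + f.1 n' := by
  rw [f.2.2]
  exact congrArg _ (mem_ker_iff_forall_apply.1 n.2 _)

lemma map_pow_of_mem_contZ1_ker (f : contZ1 (ρ.comp ρ.ker.subtype)) (n : ρ.ker) (i : ℕ) :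
    f.1 (n ^ i) = i • f.1 n := by
  induction i with
  | zero => rw [pow_zero, cocycle_map_one f.2.2, zero_smul]
  | succ i ih => rw [pow_succ, map_mul_of_mem_contZ1_ker, ih, succ_nsmul]

lemma cocycle_eq_of_inv_mul_mem {f : contZ1 (ρ.comp ρ.ker.subtype)} {H : Subgroup Γ}
    (hH : ∀ n : ρ.ker, (n : Γ) ∈ H → f.1 n = 0) {n n' : ρ.ker} (h : ((n : Γ)⁻¹ * n' : Γ) ∈ H) :
    f.1 n' = f.1 n := by
  rw [← mul_inv_cancel_left n n', map_mul_of_mem_contZ1_ker, hH (n⁻¹ * n') h, add_zero]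

theorem exists_mem_contZ1_extension_of_ker_sup_eq_top [IsTopologicalGroup Γ]
    (f : contZ1 (ρ.comp ρ.ker.subtype)) (hf : ∀ σ n, f.1 (MulAut.conjNormal σ n) = ρ σ (f.1 n))
    {H : Subgroup Γ} (hH : IsOpen (H : Set Γ)) (hsup : ρ.ker ⊔ H = ⊤)
    (hfH : ∀ n : ρ.ker, (n : Γ) ∈ H → f.1 n = 0) :
    ∃ F ∈ contZ1 ρ, ∀ n : ρ.ker, F n = f.1 n := by
  have exists_mul (x : Γ) : ∃ n : ρ.ker, ∃ h ∈ H, (n * h : Γ) = x := by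
    obtain ⟨n, hn, h, hh, hx⟩ := Subgroup.mem_sup_of_normal_left.1 (hsup ▸ Subgroup.mem_top x)
    exact ⟨⟨n, hn⟩, h, hh, hx⟩
  choose n h hh hx using exists_mul
  have map_eq (m : ρ.ker) {y : Γ} (hy : y ∈ H) : f.1 (n (m * y)) = f.1 m := by
    refine cocycle_eq_of_inv_mul_mem hfH ?_
    rw [show (m : Γ)⁻¹ * n (m * y) = y * (h (m * y))⁻¹ by
      rw [inv_mul_eq_iff_eq_mul, ← mul_assoc, eq_mul_inv_iff_mul_eq, hx]]
    exact mul_mem hy (inv_mem (hh _))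
  have hρh (x : Γ) (a : A) : ρ (h x) a = ρ x a := by
    conv_rhs => rw [← hx x, map_mul_apply, mem_ker_iff_forall_apply.1 (n x).2]
  refine ⟨fun x => f.1 (n x), mem_contZ1_of_isOpen (fun x y => ?_) hH fun y hy => ?_, fun m => ?_⟩
  · have hxy : x * y = (n x * MulAut.conjNormal (h x) (n y) : ρ.ker) * (h x * h y) := by
      conv_lhs => rw [← hx x, ← hx y]
      simp only [Subgroup.coe_mul, MulAut.conjNormal_apply]
      group
    simp only [hxy, map_eq _ (mul_mem (hh x) (hh y)), map_mul_of_mem_contZ1_ker, hf, hρh]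
  · simpa [cocycle_map_one f.2.2] using map_eq 1 hy
  · simpa using map_eq m H.one_mem

lemma cocycle_eq_zero_of_mem_zpowers_sup {f : contZ1 (ρ.comp ρ.ker.subtype)}
    (hf : ∀ σ n, f.1 (MulAut.conjNormal σ n) = ρ σ (f.1 n))
    {V : Subgroup Γ} [V.Normal] (hfV : ∀ n : ρ.ker, (n : Γ) ∈ V → f.1 n = 0) {g : Γ}
    (hg : ∀ a, ρ g a = a → a = 0) {n : ρ.ker} (hn : (n : Γ) ∈ Subgroup.zpowers g ⊔ V) :
    f.1 n = 0 := by
  refine hg _ ?_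
  rw [← hf]
  refine (cocycle_eq_of_inv_mul_mem hfV ?_)
  obtain ⟨_, ⟨t, rfl⟩, v, hv, hn⟩ := Subgroup.mem_sup_of_normal_right.1 hn
  have hgv : ((n : Γ) : Γ ⧸ V) = (g : Γ ⧸ V) ^ t := by
    rw [← hn, QuotientGroup.mk_mul, (QuotientGroup.eq_one_iff v).2 hv, mul_one,
      QuotientGroup.mk_zpow]
  rw [← QuotientGroup.eq, MulAut.conjNormal_apply]
  simp only [QuotientGroup.mk_mul, QuotientGroup.mk_inv, hgv]
  group

variable [IsTopologicalGroup Γ] [CompactSpace Γ]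

/-- If `n ≡ g ^ t` modulo `V'`, then `p ^ (a + r)` divides `t`, where `p ^ a` is the `p`-part of the
order of `g` modulo `ρ.ker ⊔ V`. So modulo `V` the element `n` is a `p ^ r`-th power in `ρ.ker`. -/
lemma exists_forall_eq_zero_of_mem_zpowers_sup (hA : IsQuasiCyclic p A) (hp : p.Prime) (hp2 : p ≠ 2)
    (hρ : ∀ a, IsOpen {g | ρ g a = a}) {f : contZ1 (ρ.comp ρ.ker.subtype)} {V : Subgroup Γ}
    [V.Normal] (hV : IsOpen (V : Set Γ))
    (hfV : ∀ n : ρ.ker, (n : Γ) ∈ V → f.1 n = 0) {r : ℕ} (hr : ∀ n, p ^ r • f.1 n = 0) {k : ℕ}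
    {g : Γ} (hg1 : g ∈ torsionKer p ρ 1) (hg : g ∉ torsionKer p ρ (k + 1)) :
    ∃ V' : Subgroup Γ, IsOpen (V' : Set Γ) ∧
      ∀ n : ρ.ker, (n : Γ) ∈ Subgroup.zpowers g ⊔ V' → f.1 n = 0 := by
  have : Finite (Γ ⧸ (ρ.ker ⊔ V)) :=
    Subgroup.quotient_finite_of_isOpen _ (Subgroup.isOpen_mono le_sup_right hV)
  obtain ⟨a, s, hs, has⟩ :=
    Nat.exists_eq_pow_mul_and_not_dvd (orderOf_pos (g : Γ ⧸ (ρ.ker ⊔ V))).ne' p hp.ne_one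
  refine ⟨V ⊓ torsionKer p ρ (k + (a + r)),
    hV.inter (isOpen_torsionKer hA hp hρ _), fun n hn => ?_⟩
  obtain ⟨_, ⟨t, rfl⟩, v, ⟨hvV, hv⟩, hn⟩ := Subgroup.mem_sup_of_normal_right.1 hn
  have hgt : g ^ t = n * v⁻¹ := eq_mul_inv_of_mul_eq hn
  have hdvd : (orderOf (g : Γ ⧸ (ρ.ker ⊔ V)) : ℤ) * p ^ r ∣ t := by
    have hpt : (p : ℤ) ^ (a + r) ∣ t := by
      refine pow_dvd_of_zpow_mem_torsionKer hA hp hp2 hg1 hg ?_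
      rw [hgt]
      exact mul_mem (ker_le_torsionKer _ _ _ n.2) (inv_mem hv)
    have hst : (orderOf (g : Γ ⧸ (ρ.ker ⊔ V)) : ℤ) ∣ t := by
      rw [orderOf_dvd_iff_zpow_eq_one, ← QuotientGroup.mk_zpow, QuotientGroup.eq_one_iff, hgt]
      exact Subgroup.mul_mem_sup n.2 (inv_mem hvV)
    rw [has] at hst ⊢
    push_cast at hst ⊢
    rw [mul_right_comm, ← pow_add]
    have hcop : IsCoprime (p : ℤ) s := Nat.isCoprime_iff_coprime.2 (hp.coprime_iff_not_dvd.2 hs)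
    exact hcop.pow_left.mul_dvd hpt ((dvd_mul_left _ _).trans hst)
  obtain ⟨q, rfl⟩ := hdvd
  have hgq : g ^ (orderOf (g : Γ ⧸ (ρ.ker ⊔ V)) * q) ∈ ρ.ker ⊔ V := by
    rw [← QuotientGroup.eq_one_iff, QuotientGroup.mk_zpow, ← orderOf_dvd_iff_zpow_eq_one]
    exact dvd_mul_right _ _
  obtain ⟨n', hn', v', hv', hgq⟩ := Subgroup.mem_sup_of_normal_right.1 hgq
  have hnn' : (((⟨n', hn'⟩ ^ p ^ r : ρ.ker) : Γ) : Γ ⧸ V) = (n : Γ) := by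
    have hv1 : (v : Γ ⧸ V) = 1 := (QuotientGroup.eq_one_iff v).2 hvV
    have hv'1 : (v' : Γ ⧸ V) = 1 := (QuotientGroup.eq_one_iff v').2 hv'
    have hn1 := congrArg (QuotientGroup.mk (s := V)) hn
    have hgq1 := congrArg (QuotientGroup.mk (s := V)) hgq
    simp only [QuotientGroup.mk_mul, hv1, hv'1, mul_one, QuotientGroup.mk_zpow] at hn1 hgq1
    rw [← hn1, mul_right_comm, zpow_mul, ← hgq1]
    norm_cast
  rw [cocycle_eq_of_inv_mul_mem hfV (QuotientGroup.eq.1 hnn'), map_pow_of_mem_contZ1_ker, hr]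

lemma exists_forall_pow_smul_eq_zero (hA : IsQuasiCyclic p A) (hp : p.Prime)
    (hρ : ∀ a, IsOpen {g | ρ g a = a}) (f : contZ1 (ρ.comp ρ.ker.subtype)) :
    ∃ r : ℕ, ∀ n, p ^ r • f.1 n = 0 := by
  have := isCompact_iff_compactSpace.1 (isClosed_ker hA hp hρ).isCompact
  choose m hm using hA.exists_pow_smul_eq_zero
  obtain ⟨r, hr⟩ := (f.2.1.range_finite.image m).bddAbove
  refine ⟨r, fun n => addOrderOf_dvd_iff_nsmul_eq_zero.1 ?_⟩
  exact (addOrderOf_dvd_of_nsmul_eq_zero (hm _)).trans (pow_dvd_pow p (hr ⟨_, ⟨n, rfl⟩, rfl⟩))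

lemma exists_isOpen_ker_sup_eq_top [TotallyDisconnectedSpace Γ] (hA : IsQuasiCyclic p A)
    (hp : p.Prime) (hp2 : p ≠ 2) (hρ : ∀ a, IsOpen {g | ρ g a = a})
    {f : contZ1 (ρ.comp ρ.ker.subtype)} (hf : ∀ σ n, f.1 (MulAut.conjNormal σ n) = ρ σ (f.1 n)) :
    ∃ H : Subgroup Γ, IsOpen (H : Set Γ) ∧ ρ.ker ⊔ H = ⊤ ∧
      ∀ n : ρ.ker, (n : Γ) ∈ H → f.1 n = 0 := by
  obtain ⟨U, hU, hUf⟩ := isOpen_induced_iff.1 (f.2.1 {0})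
  obtain ⟨V, hVU⟩ := ProfiniteGrp.exist_openNormalSubgroup_sub_open_nhds_of_one hU
    ((Set.ext_iff.1 hUf 1).2 (cocycle_map_one f.2.2))
  have hfV (n : ρ.ker) (hn : (n : Γ) ∈ V.toSubgroup) : f.1 n = 0 :=
    (Set.ext_iff.1 hUf n).1 (hVU hn)
  have isOpen_sup {W W' : Subgroup Γ} (hW' : IsOpen (W' : Set Γ)) :
      IsOpen ((W ⊔ W' : Subgroup Γ) : Set Γ) :=
    Subgroup.isOpen_mono le_sup_right hW'
  obtain ⟨g, hg⟩ := exists_isTopologicalGeneratorMod_ker hA hp hp2 hρ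
  by_cases hgker : g ∈ ρ.ker
  · exact ⟨V, V.isOpen, hg _ (isOpen_sup V.isOpen) le_sup_left (Subgroup.mem_sup_left hgker), hfV⟩
  suffices h : ∃ V' : Subgroup Γ, IsOpen (V' : Set Γ) ∧
      ∀ n : ρ.ker, (n : Γ) ∈ Subgroup.zpowers g ⊔ V' → f.1 n = 0 by
    obtain ⟨V', hV', hfV'⟩ := h
    exact ⟨_, isOpen_sup hV', hg _ (isOpen_sup (isOpen_sup hV')) le_sup_left
      (Subgroup.mem_sup_right (Subgroup.mem_sup_left (Subgroup.mem_zpowers g))), hfV'⟩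
  by_cases hg1 : g ∈ torsionKer p ρ 1
  · obtain ⟨k, hk⟩ := exists_notMem_torsionKer hA hgker
    obtain ⟨r, hr⟩ := exists_forall_pow_smul_eq_zero hA hp hρ f
    exact exists_forall_eq_zero_of_mem_zpowers_sup hA hp hp2 hρ V.isOpen hfV hr
      hg1 fun h => hk (torsionKer_antitone p ρ k.le_succ h)
  · exact ⟨V, V.isOpen, fun n hn =>
      cocycle_eq_zero_of_mem_zpowers_sup hf hfV (fun a => eq_zero_of_apply_eq_self hA hp hg1) hn⟩

theorem exists_mem_contZ1_extension [TotallyDisconnectedSpace Γ] (hA : IsQuasiCyclic p A)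
    (hp : p.Prime) (hp2 : p ≠ 2) (hρ : ∀ a, IsOpen {g | ρ g a = a})
    (f : contZ1 (ρ.comp ρ.ker.subtype))
    (hf : ∀ σ n, f.1 (MulAut.conjNormal σ n) = ρ σ (f.1 n)) :
    ∃ F ∈ contZ1 ρ, ∀ n : ρ.ker, F n = f.1 n :=
  have ⟨_, hH, hsup, hfH⟩ := exists_isOpen_ker_sup_eq_top hA hp hp2 hρ hf
  exists_mem_contZ1_extension_of_ker_sup_eq_top f hf hH hsup hfH

end CocycleExtension

section GaloisCohomology

section

variable {G A : Type*} [Group G] [TopologicalSpace G] [AddCommGroup A] {ρ : G →* AddMonoid.End A}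

lemma contH1_mk_eq_zero_iff (f : contZ1 ρ) :
    (QuotientAddGroup.mk f : contH1 ρ) = 0 ↔ ∃ a : A, ∀ g, f.1 g = ρ g a - a := by
  rw [QuotientAddGroup.eq_zero_iff]
  rfl

lemma contH1_mk_eq_iff (f f' : contZ1 ρ) :
    (QuotientAddGroup.mk f : contH1 ρ) = QuotientAddGroup.mk f' ↔
      ∃ a : A, ∀ g, f.1 g - f'.1 g = ρ g a - a := by
  rw [← sub_eq_zero, ← QuotientAddGroup.mk_sub, contH1_mk_eq_zero_iff]
  rfl

end

variable {p : ℕ} {K : Type u} {Kbar : Type v} [Field K] [Field Kbar] [Algebra K Kbar]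
  {A : Type w} [AddCommGroup A] {ρ : Gal(Kbar/K) →* AddMonoid.End A}
  {L F : IntermediateField K Kbar}

lemma apply_eq_self_of_mem_fixingSubgroup (hF : F.fixingSubgroup = L.fixingSubgroup ⊓ ρ.ker)
    {σ : Gal(Kbar/K)} (hσ : σ ∈ F.fixingSubgroup) (a : A) : ρ σ a = a :=
  mem_ker_iff_forall_apply.1 (hF ▸ hσ).2 a

lemma mem_fixingSubgroup_of_mem_ker (hF : F.fixingSubgroup = L.fixingSubgroup ⊓ ρ.ker)
    {σ : L.fixingSubgroup} (hσ : σ ∈ (ρ.comp L.fixingSubgroup.subtype).ker) :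
    (σ : Gal(Kbar/K)) ∈ F.fixingSubgroup :=
  hF ▸ ⟨σ.2, hσ⟩

variable [IsGalois K Kbar]

instance compactSpace_fixingSubgroup (F : IntermediateField K Kbar) :
    CompactSpace F.fixingSubgroup :=
  isCompact_iff_compactSpace.1 (InfiniteGalois.fixingSubgroup_isClosed F).isCompact

lemma galRes_injective (hA : IsQuasiCyclic p A) (hp : p.Prime) (hp2 : p ≠ 2)
    (hρ : ∀ a, IsOpen {g | ρ g a = a}) (h : L ≤ F)
    (hF : F.fixingSubgroup = L.fixingSubgroup ⊓ ρ.ker) : Function.Injective (galRes ρ h) := by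
  refine (injective_iff_map_eq_zero _).2 fun c hc => ?_
  obtain ⟨f, rfl⟩ := QuotientAddGroup.mk_surjective c
  obtain ⟨a, ha⟩ := (contH1_mk_eq_zero_iff _).1 hc
  rw [contH1_mk_eq_zero_iff]
  refine mem_contB1_of_forall_mem_ker (ρ := ρ.comp L.fixingSubgroup.subtype) hA hp hp2
    (fun a => (hρ a).preimage continuous_subtype_val) f.2 fun n hn => ?_
  have hnF := mem_fixingSubgroup_of_mem_ker hF hn
  exact (ha ⟨n, hnF⟩).trans (sub_eq_zero.2 (apply_eq_self_of_mem_fixingSubgroup hF hnF a))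

lemma galConj_galRes [IsGalois K L] [IsGalois K F] (h : L ≤ F) (σ : Gal(Kbar/K))
    (c : galH1 ρ L) : galRes ρ h (galConj ρ L σ c) = galConj ρ F σ (galRes ρ h c) := by
  obtain ⟨f, rfl⟩ := QuotientAddGroup.mk_surjective c
  rfl

lemma galConj_galRes_of_mem [IsGalois K F] (h : L ≤ F) {σ : Gal(Kbar/K)}
    (hσ : σ ∈ L.fixingSubgroup) (c : galH1 ρ L) :
    galConj ρ F σ (galRes ρ h c) = galRes ρ h c := by
  obtain ⟨f, rfl⟩ := QuotientAddGroup.mk_surjective c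
  let s : L.fixingSubgroup := ⟨σ, hσ⟩
  refine (contH1_mk_eq_iff _ _).2 ⟨f.1 s, fun g => ?_⟩
  let t : L.fixingSubgroup := Subgroup.inclusion (IntermediateField.fixingSubgroup_antitone h) g
  have hcomm : f.1 (s * (s⁻¹ * t * s⁻¹⁻¹)) = f.1 (t * s) := congrArg f.1 (by group)
  rw [f.2.2 s, f.2.2 t] at hcomm
  change ρ σ (f.1 (s⁻¹ * t * s⁻¹⁻¹)) - f.1 t = ρ g (f.1 s) - f.1 s
  rw [sub_eq_sub_iff_add_eq_add, add_comm, add_comm (ρ g _)]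
  exact hcomm

theorem mem_range_galRes [IsGalois K F] (hA : IsQuasiCyclic p A) (hp : p.Prime) (hp2 : p ≠ 2)
    (hρ : ∀ a, IsOpen {g | ρ g a = a}) (h : L ≤ F)
    (hF : F.fixingSubgroup = L.fixingSubgroup ⊓ ρ.ker) {c : galH1 ρ F}
    (hc : ∀ σ ∈ L.fixingSubgroup, galConj ρ F σ c = c) : ∃ c', galRes ρ h c' = c := by
  obtain ⟨f, rfl⟩ := QuotientAddGroup.mk_surjective c
  let ρL := ρ.comp L.fixingSubgroup.subtype
  let j : ρL.ker →* F.fixingSubgroup :=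
    (L.fixingSubgroup.subtype.comp ρL.ker.subtype).codRestrict _ fun n =>
      mem_fixingSubgroup_of_mem_ker hF n.2
  have hj : Continuous j :=
    (continuous_subtype_val.comp continuous_subtype_val).subtype_mk fun n =>
      mem_fixingSubgroup_of_mem_ker hF n.2
  let f' : contZ1 (ρL.comp ρL.ker.subtype) :=
    contZ1Map _ _ j hj (AddMonoidHom.id A) (fun _ _ => rfl) f
  have hf' (σ : L.fixingSubgroup) (n : ρL.ker) :
      f'.1 (MulAut.conjNormal σ n) = ρL σ (f'.1 n) := by
    obtain ⟨a, ha⟩ := (contH1_mk_eq_iff _ _).1 (hc σ σ.2)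
    have hfix := apply_eq_self_of_mem_fixingSubgroup hF (j (MulAut.conjNormal σ n)).2 a
    have heq := sub_eq_zero.1 ((ha (j (MulAut.conjNormal σ n))).trans (sub_eq_zero.2 hfix))
    refine heq.symm.trans (congrArg (fun x => ρ σ (f.1 x)) (Subtype.ext ?_))
    change (σ : Gal(Kbar/K))⁻¹ * (σ * n * (σ : Gal(Kbar/K))⁻¹) * (σ : Gal(Kbar/K))⁻¹⁻¹ = n
    group
  obtain ⟨E, hE, hEf⟩ := exists_mem_contZ1_extension (ρ := ρL) hA hp hp2
    (fun a => (hρ a).preimage continuous_subtype_val) f' hf'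
  refine ⟨QuotientAddGroup.mk ⟨E, hE⟩, congrArg _ (Subtype.ext (funext fun x => ?_))⟩
  exact hEf ⟨⟨x, IntermediateField.fixingSubgroup_antitone h x.2⟩,
    mem_ker_iff_forall_apply.2 (apply_eq_self_of_mem_fixingSubgroup hF x.2)⟩

end GaloisCohomology

section Localization

variable {p : ℕ} {K : Type u} {Kbar : Type v} [Field K] [Field Kbar] [Algebra K Kbar]
  [Normal K Kbar] {Kv : Type u} {Ω : Type w} [Field Kv] [Field Ω] [Algebra K Kv] [Algebra Kv Ω]
  [Algebra K Ω] [IsScalarTower K Kv Ω] {A : Type*} [AddCommGroup A]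
  {ρ : Gal(Kbar/K) →* AddMonoid.End A} {L F : IntermediateField K Kbar}

lemma mem_fixingSubgroup_localField {τ : Kbar →ₐ[K] Ω} {g : Gal(Ω/Kv)}
    (hg : localToGlobal τ g ∈ F.fixingSubgroup) : g ∈ (localField Kv τ F).fixingSubgroup := by
  rintro ⟨x, hx⟩
  change g x = x
  induction hx using IntermediateField.adjoin_induction with
  | mem x hx =>
    obtain ⟨y, hy, rfl⟩ := hx
    rw [← apply_localToGlobal]
    exact congrArg τ (hg ⟨y, hy⟩)
  | algebraMap x => exact AlgEquiv.commutes _ x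
  | add x y _ _ hx hy => rw [map_add, hx, hy]
  | inv x _ hx => rw [map_inv₀, hx]
  | mul x y _ _ hx hy => rw [map_mul, hx, hy]

lemma localization_galRes_eq_zero_iff [IsGalois Kv Ω] (hA : IsQuasiCyclic p A) (hp : p.Prime)
    (hp2 : p ≠ 2) (hρ : ∀ a, IsOpen {g | ρ g a = a}) (h : L ≤ F)
    (hF : F.fixingSubgroup = L.fixingSubgroup ⊓ ρ.ker) (τ : Kbar →ₐ[K] Ω) (c : galH1 ρ L) :
    localization Kv ρ τ F (galRes ρ h c) = 0 ↔ localization Kv ρ τ L c = 0 := by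
  obtain ⟨f, rfl⟩ := QuotientAddGroup.mk_surjective c
  refine ⟨fun hc => ?_, fun hc => ?_⟩ <;> obtain ⟨a, ha⟩ := (contH1_mk_eq_zero_iff _).1 hc <;>
    refine (contH1_mk_eq_zero_iff _).2 ?_
  · have hcont := continuous_localToGlobalOver (Kv := Kv) τ L
    refine mem_contB1_of_forall_mem_ker
      (ρ := (ρ.comp L.fixingSubgroup.subtype).comp (localToGlobalOver Kv τ L)) hA hp hp2
      (fun a => (hρ a).preimage (continuous_subtype_val.comp hcont))
      ((contZ1Map _ _ (localToGlobalOver Kv τ L) hcont (AddMonoidHom.id A) fun _ _ => rfl) f).2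
      fun n hn => ?_
    have hnF : localToGlobal τ n.1 ∈ F.fixingSubgroup := mem_fixingSubgroup_of_mem_ker hF hn
    exact (ha ⟨n, mem_fixingSubgroup_localField hnF⟩).trans
      (sub_eq_zero.2 (apply_eq_self_of_mem_fixingSubgroup hF hnF a))
  · have hle : localField Kv τ L ≤ localField Kv τ F :=
      IntermediateField.adjoin.mono _ _ _ (Set.image_mono h)
    exact ⟨a, fun g => ha ⟨g, IntermediateField.fixingSubgroup_antitone hle g.2⟩⟩

end Localization

section Selmer

variable {p : ℕ} {K : Type u} [Field K] [NumberField K] {Kbar : Type v} [Field Kbar]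
  [Algebra K Kbar] [IsGalois K Kbar] {A : Type w} [AddCommGroup A]
  {ρ : Gal(Kbar/K) →* AddMonoid.End A} {L F : IntermediateField K Kbar}

lemma mem_imprimitiveSelmer_iff {S : Finset (HeightOneSpectrum (𝓞 K))} {c : galH1 ρ F} :
    c ∈ imprimitiveSelmer ρ S F ↔ ∀ v ∉ S,
      ∀ τ : Kbar →ₐ[K] AlgebraicClosure (v.adicCompletion K),
        localization (v.adicCompletion K) ρ τ F c = 0 := by
  simp only [imprimitiveSelmer, AddSubgroup.mem_iInf, AddMonoidHom.mem_ker]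

lemma mem_selmerInvariants_iff [IsGalois K F] {S : Finset (HeightOneSpectrum (𝓞 K))}
    {c : galH1 ρ F} :
    c ∈ selmerInvariants ρ S L F ↔
      c ∈ imprimitiveSelmer ρ S F ∧ ∀ σ ∈ L.fixingSubgroup, galConj ρ F σ c = c := by
  simp only [selmerInvariants, AddSubgroup.mem_inf, AddSubgroup.mem_iInf, AddMonoidHom.mem_ker,
    AddMonoidHom.sub_apply, AddMonoidHom.id_apply, sub_eq_zero]

lemma galRes_mem_imprimitiveSelmer_iff (hA : IsQuasiCyclic p A) (hp : p.Prime) (hp2 : p ≠ 2)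
    (hρ : ∀ a, IsOpen {g | ρ g a = a}) (h : L ≤ F)
    (hF : F.fixingSubgroup = L.fixingSubgroup ⊓ ρ.ker) (S : Finset (HeightOneSpectrum (𝓞 K)))
    (c : galH1 ρ L) :
    galRes ρ h c ∈ imprimitiveSelmer ρ S F ↔ c ∈ imprimitiveSelmer ρ S L := by
  rw [mem_imprimitiveSelmer_iff, mem_imprimitiveSelmer_iff]
  refine forall_congr' fun v => forall_congr' fun _ => forall_congr' fun τ => ?_
  have : CharZero (v.adicCompletion K) := charZero_of_injective_algebraMap
    (FaithfulSMul.algebraMap_injective K (v.adicCompletion K))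
  exact localization_galRes_eq_zero_iff hA hp hp2 hρ h hF τ c

theorem exists_selmer_equiv [IsGalois K F] (hA : IsQuasiCyclic p A) (hp : p.Prime) (hp2 : p ≠ 2)
    (hρ : ∀ a, IsOpen {g | ρ g a = a}) (h : L ≤ F)
    (hF : F.fixingSubgroup = L.fixingSubgroup ⊓ ρ.ker) (S : Finset (HeightOneSpectrum (𝓞 K))) :
    ∃ e : imprimitiveSelmer ρ S L ≃+ selmerInvariants ρ S L F,
      ∀ c : imprimitiveSelmer ρ S L, (e c : galH1 ρ F) = galRes ρ h c := by
  have hmem := galRes_mem_imprimitiveSelmer_iff hA hp hp2 hρ h hF S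
  let φ : imprimitiveSelmer ρ S L →+ selmerInvariants ρ S L F :=
    ((galRes ρ h).comp (imprimitiveSelmer ρ S L).subtype).codRestrict _ fun c =>
      mem_selmerInvariants_iff.2 ⟨(hmem _).2 c.2, fun σ hσ => galConj_galRes_of_mem h hσ _⟩
  refine ⟨AddEquiv.ofBijective φ ⟨fun a b hab => ?_, fun c => ?_⟩, fun _ => rfl⟩
  · exact Subtype.ext (galRes_injective hA hp hp2 hρ h hF (congrArg Subtype.val hab))
  · obtain ⟨hc, hinv⟩ := mem_selmerInvariants_iff.1 c.2
    obtain ⟨c', hc'⟩ := mem_range_galRes hA hp hp2 hρ h hF hinv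
    exact ⟨⟨c', (hmem _).1 (hc'.symm ▸ hc)⟩, Subtype.ext hc'⟩

end Selmer

section XCoordinate

open Filter Polynomial WeierstrassCurve.Affine

variable {F : Type*} [Field F] {V : WeierstrassCurve.Affine F}

/-- `P` is an affine point with `x`-coordinate `x`. -/
def HasX (P : V.Point) (x : F) : Prop := ∃ y h, P = .some x y h

namespace HasX

variable {P Q : V.Point} {x x' : F}

lemma unique (h : HasX P x) (h' : HasX P x') : x = x' := by
  obtain ⟨y, hy, rfl⟩ := h
  obtain ⟨y', hy', h'⟩ := h'
  exact (Point.some.inj h').1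

lemma ne_zero (h : HasX P x) : P ≠ 0 := by
  obtain ⟨y, hy, rfl⟩ := h
  exact Point.some_ne_zero hy

lemma neg (h : HasX P x) : HasX (-P) x := by
  obtain ⟨y, hy, rfl⟩ := h
  exact ⟨_, _, Point.neg_some hy⟩

lemma eq_or_eq_neg (h : HasX P x) (h' : HasX Q x) : P = Q ∨ P = -Q := by
  obtain ⟨y, hy, rfl⟩ := h
  obtain ⟨y', hy', rfl⟩ := h'
  exact Point.X_eq_iff.1 rfl

end HasX

lemma exists_hasX_of_ne_zero {P : V.Point} (h : P ≠ 0) : ∃ x, HasX P x := by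
  obtain _ | ⟨x, y, hxy⟩ := P
  · exact absurd rfl h
  · exact ⟨x, y, hxy, rfl⟩

lemma exists_hasX [IsAlgClosed F] [V.IsElliptic] (x : F) : ∃ P : V.Point, HasX P x := by
  let q : F[X] := C 1 * X ^ 2 + C (V.a₁ * x + V.a₃) * X
    + C (-(x ^ 3 + V.a₂ * x ^ 2 + V.a₄ * x + V.a₆))
  have hq : q.degree = 2 := degree_quadratic one_ne_zero
  obtain ⟨y, hy⟩ := IsAlgClosed.exists_root q (by rw [hq]; decide)
  refine ⟨.some x y (equation_iff_nonsingular.1 ?_), y, _, rfl⟩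
  rw [equation_iff]
  simp only [IsRoot, q, eval_add, eval_mul, eval_C, eval_pow, eval_X] at hy
  linear_combination hy

lemma exists_setOf_hasX_subset_pair (x : F) :
    ∃ P : V.Point, {Q : V.Point | HasX Q x} ⊆ {P, -P} := by
  by_cases h : ∃ P : V.Point, HasX P x
  · obtain ⟨P, hP⟩ := h
    exact ⟨P, fun Q hQ => HasX.eq_or_eq_neg hQ hP⟩
  · exact ⟨0, fun Q hQ => absurd ⟨Q, hQ⟩ h⟩

lemma finite_setOf_hasX (x : F) : {P : V.Point | HasX P x}.Finite :=
  have ⟨_, hP⟩ := exists_setOf_hasX_subset_pair x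
  (Set.toFinite _).subset hP

lemma ncard_setOf_hasX_le_two (x : F) : {P : V.Point | HasX P x}.ncard ≤ 2 :=
  have ⟨P, hP⟩ := exists_setOf_hasX_subset_pair x
  (Set.ncard_le_ncard hP (Set.toFinite _)).trans <|
    (Set.ncard_insert_le _ _).trans (by rw [Set.ncard_singleton])

lemma eventually_hasX {q : F → Prop} (h : ∀ᶠ x in cofinite, q x) :
    ∀ᶠ P : V.Point in cofinite, ∃ x, HasX P x ∧ q x := by
  rw [eventually_cofinite] at h ⊢
  refine ((h.biUnion fun x _ => finite_setOf_hasX (V := V) x).insert 0).subset fun P hP => ?_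
  by_cases h0 : P = 0
  · exact Or.inl h0
  obtain ⟨x, hx⟩ := exists_hasX_of_ne_zero h0
  exact Or.inr (Set.mem_biUnion (x := x) (fun hqx => hP ⟨x, hx, hqx⟩) hx)

lemma eventually_forall_hasX {q : V.Point → Prop} (h : ∀ᶠ P in cofinite, q P) :
    ∀ᶠ x in cofinite, ∀ P : V.Point, HasX P x → q P := by
  rw [eventually_cofinite] at h ⊢
  refine (h.biUnion fun P _ => (Set.Subsingleton.finite (s := {x | HasX P x})
    fun _ hx _ hx' => HasX.unique hx hx')).subset fun x hx => ?_
  push Not at hx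
  obtain ⟨P, hP, hqP⟩ := hx
  exact Set.mem_biUnion (x := P) hqP hP

lemma infinite_point_of_isAlgClosed [IsAlgClosed F] [V.IsElliptic] : Infinite V.Point := by
  have : Infinite F := IsAlgClosed.instInfinite
  choose P hP using exists_hasX (V := V)
  exact Infinite.of_injective P fun x x' h => (hP x).unique (h ▸ hP x')

lemma eventually_eval_ne_zero {q : F[X]} (hq : q ≠ 0) : ∀ᶠ x in cofinite, q.eval x ≠ 0 :=
  (finite_setOfPred_isRoot hq).subset fun _ => not_not.1

lemma eventually_ne_negY [CharZero F] :
    ∀ᶠ P : V.Point in cofinite, ∃ x y h, P = .some x y h ∧ y ≠ V.negY x y := by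
  let q : F[X] := C 4 * X ^ 3 + C V.b₂ * X ^ 2 + C (2 * V.b₄) * X + C V.b₆
  have hq : q ≠ 0 := ne_zero_of_degree_gt (n := 2)
    ((degree_cubic (show (4 : F) ≠ 0 by norm_num)).symm ▸ by decide)
  filter_upwards [eventually_hasX (V := V) (eventually_eval_ne_zero hq)] with P ⟨x, ⟨y, h, hP⟩, hx⟩
  refine ⟨x, y, h, hP, fun hy => hx ?_⟩
  have heq := (equation_iff _ _).1 h.1
  rw [negY] at hy
  simp only [q, eval_add, eval_mul, eval_C, eval_pow, eval_X, WeierstrassCurve.b₂,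
    WeierstrassCurve.b₄, WeierstrassCurve.b₆]
  linear_combination (2 * y + V.a₁ * x + V.a₃) * hy - 4 * heq

lemma exists_aeval_eq_linear {K : Type*} [Field K] [Algebra K F] (V : WeierstrassCurve.Affine F)
    (q : MvPolynomial (Fin 2) K) :
    ∃ q₀ q₁ : F[X], ∀ x y, V.Equation x y →
      MvPolynomial.aeval ![x, y] q = q₀.eval x + q₁.eval x * y := by
  induction q using MvPolynomial.induction_on with
  | C a => exact ⟨C (algebraMap K F a), 0, fun x y _ => by simp⟩
  | add f g hf hg =>
    obtain ⟨f₀, f₁, hf⟩ := hf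
    obtain ⟨g₀, g₁, hg⟩ := hg
    refine ⟨f₀ + g₀, f₁ + g₁, fun x y h => ?_⟩
    rw [map_add, hf x y h, hg x y h, eval_add, eval_add]
    ring
  | mul_X f i hf =>
    obtain ⟨f₀, f₁, hf⟩ := hf
    fin_cases i
    · refine ⟨f₀ * X, f₁ * X, fun x y h => ?_⟩
      rw [map_mul, hf x y h, MvPolynomial.aeval_X, eval_mul_X, eval_mul_X, add_mul,
        mul_right_comm _ y]
      rfl
    · refine ⟨f₁ * (X ^ 3 + C V.a₂ * X ^ 2 + C V.a₄ * X + C V.a₆), f₀ - f₁ * (C V.a₁ * X + C V.a₃),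
        fun x y h => ?_⟩
      rw [map_mul, hf x y h, MvPolynomial.aeval_X]
      change (f₀.eval x + f₁.eval x * y) * y = _
      simp only [eval_add, eval_sub, eval_mul, eval_pow, eval_C, eval_X]
      linear_combination f₁.eval x * (equation_iff _ _).1 h

variable [DecidableEq F]

section AddSub

variable {u v y z : F}

lemma addX_slope_mul_sub_sq (h : u ≠ v) :
    V.addX u v (V.slope u v y z) * (u - v) ^ 2 =
      (y - z) ^ 2 + V.a₁ * (y - z) * (u - v) - (V.a₂ + u + v) * (u - v) ^ 2 := by
  have : u - v ≠ 0 := sub_ne_zero.2 h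
  rw [slope_of_X_ne h, addX]
  field_simp
  ring

lemma addX_slope_add_addX_slope_negY (h : u ≠ v) (hu : V.Equation u y) (hv : V.Equation v z) :
    (V.addX u v (V.slope u v y z) + V.addX u v (V.slope u v y (V.negY v z))) * (u - v) ^ 2 =
      2 * u * v * (u + v) + V.b₂ * u * v + V.b₄ * (u + v) + V.b₆ := by
  rw [add_mul, addX_slope_mul_sub_sq h, addX_slope_mul_sub_sq h, negY]
  rw [equation_iff] at hu hv
  rw [WeierstrassCurve.b₂, WeierstrassCurve.b₄, WeierstrassCurve.b₆]
  linear_combination 2 * hu + 2 * hv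

lemma addX_slope_mul_addX_slope_negY (h : u ≠ v) (hu : V.Equation u y) (hv : V.Equation v z) :
    V.addX u v (V.slope u v y z) * V.addX u v (V.slope u v y (V.negY v z)) * (u - v) ^ 2 =
      u ^ 2 * v ^ 2 - V.b₄ * u * v - V.b₆ * (u + v) - V.b₈ := by
  apply mul_right_cancel₀ (pow_ne_zero 2 (sub_ne_zero.2 h))
  rw [mul_assoc (_ * _), mul_mul_mul_comm, addX_slope_mul_sub_sq h, addX_slope_mul_sub_sq h, negY]
  rw [equation_iff] at hu hv
  rw [WeierstrassCurve.b₄, WeierstrassCurve.b₆, WeierstrassCurve.b₈]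
  clear h
  grind

end AddSub

/-- The endomorphism `φ` is given on `x`-coordinates, away from finitely many points, by the
rational function `r / s`, which is in lowest terms. -/
def IsXMap (φ : AddMonoid.End V.Point) (r s : F[X]) : Prop :=
  IsCoprime r s ∧
    ∀ᶠ x in cofinite, s.eval x ≠ 0 ∧ ∀ P : V.Point, HasX P x → HasX (φ P) (r.eval x / s.eval x)

section ExistsIsXMap

variable {φ : AddMonoid.End V.Point}

lemma exists_isXMap_of_eval {a b : F[X]} (hb : b ≠ 0)
    (h : ∀ᶠ P in cofinite, ∃ x x', HasX P x ∧ HasX (φ P) x' ∧ a.eval x = x' * b.eval x) :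
    ∃ r s, IsXMap φ r s := by
  classical
  obtain ⟨r, hr⟩ := EuclideanDomain.gcd_dvd_left a b
  obtain ⟨s, hs⟩ := EuclideanDomain.gcd_dvd_right a b
  have hrs : IsCoprime r s := by
    have hg : EuclideanDomain.gcd a b ≠ 0 := fun h => hb (EuclideanDomain.gcd_eq_zero_iff.1 h).2
    refine ⟨EuclideanDomain.gcdA a b, EuclideanDomain.gcdB a b, mul_left_cancel₀ hg ?_⟩
    linear_combination -EuclideanDomain.gcdA a b * hr - EuclideanDomain.gcdB a b * hs -
      EuclideanDomain.gcd_eq_gcd_ab a b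
  refine ⟨r, s, hrs, ?_⟩
  filter_upwards [eventually_forall_hasX h, eventually_eval_ne_zero hb] with x hx hbx
  have hax := congrArg (eval x) hr
  have hbx' := congrArg (eval x) hs
  rw [eval_mul] at hax hbx'
  rw [hbx'] at hbx
  have hsx := right_ne_zero_of_mul hbx
  refine ⟨hsx, fun P hP => ?_⟩
  obtain ⟨x₁, x', hPx, hφP, heq⟩ := hx P hP
  obtain rfl := hP.unique hPx
  rw [hax, hbx', mul_left_comm] at heq
  rwa [(div_eq_iff hsx).2 (mul_left_cancel₀ (left_ne_zero_of_mul hbx) heq)]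

/-- Since `φ (-P) = -φ P` has the same `x`-coordinate as `φ P`, the numerator and the denominator
of `x ∘ φ` are proportional at both `y` and `negY x y`, hence coefficientwise in `y`. -/
lemma exists_isXMap_of_linear [CharZero F] [IsAlgClosed F] [V.IsElliptic] {f₀ f₁ d₀ d₁ : F[X]}
    (h : ∀ᶠ P in cofinite, ∃ x y x' h, P = .some x y h ∧ HasX (φ P) x' ∧
      d₀.eval x + d₁.eval x * y ≠ 0 ∧
      f₀.eval x + f₁.eval x * y = x' * (d₀.eval x + d₁.eval x * y)) :
    ∃ r s, IsXMap φ r s := by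
  have hcoeff : ∀ᶠ P in cofinite, ∃ x x', HasX P x ∧ HasX (φ P) x' ∧
      f₀.eval x = x' * d₀.eval x ∧ f₁.eval x = x' * d₁.eval x := by
    have hneg : Tendsto (fun P : V.Point => -P) cofinite cofinite := neg_injective.tendsto_cofinite
    filter_upwards [h, hneg.eventually h, eventually_ne_negY] with P
      ⟨x, y, x', hxy, hP, hφP, _, heq⟩ ⟨_, _, x'', _, hP', hφP', _, heq'⟩ ⟨_, _, _, hP'', hy⟩
    rw [hP, Point.neg_some] at hP'
    obtain ⟨rfl, rfl⟩ := Point.some.inj hP'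
    obtain ⟨rfl, rfl⟩ := Point.some.inj (hP.symm.trans hP'')
    rw [map_neg] at hφP'
    obtain rfl := hφP.unique (neg_neg (φ P) ▸ hφP'.neg)
    have h₁ : f₁.eval x = x' * d₁.eval x := by
      apply mul_right_cancel₀ (sub_ne_zero.2 hy)
      linear_combination heq - heq'
    exact ⟨x, x', ⟨y, hxy, hP⟩, hφP, by linear_combination heq - y * h₁, h₁⟩
  by_cases hd : d₁ = 0
  · have := infinite_point_of_isAlgClosed (V := V)
    refine exists_isXMap_of_eval (a := f₀) (b := d₀) ?_
      (hcoeff.mono fun P ⟨x, x', hP, hφP, h₀, _⟩ => ⟨x, x', hP, hφP, h₀⟩)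
    rintro rfl
    obtain ⟨P, x, y, x', -, -, -, hne, -⟩ := h.exists
    simp [hd] at hne
  · exact exists_isXMap_of_eval hd
      (hcoeff.mono fun P ⟨x, x', hP, hφP, _, h₁⟩ => ⟨x, x', hP, hφP, h₁⟩)

end ExistsIsXMap

lemma IsEndomorphism.exists_isXMap {K : Type u} [Field K] {W : WeierstrassCurve.Affine K}
    {Kbar : Type v} [Field Kbar] [Algebra K Kbar] [DecidableEq Kbar] [CharZero Kbar]
    [IsAlgClosed Kbar] [W.IsElliptic] {φ : AddMonoid.End (W.baseChange Kbar).Point}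
    (hφ : IsEndomorphism W Kbar φ) (h0 : φ ≠ 0) : ∃ r s, IsXMap φ r s := by
  obtain ⟨f, g, d, hfin⟩ := hφ.resolve_left h0
  obtain ⟨f₀, f₁, hf⟩ := exists_aeval_eq_linear (W.baseChange Kbar) f
  obtain ⟨d₀, d₁, hd⟩ := exists_aeval_eq_linear (W.baseChange Kbar) d
  have hgiven : ∀ᶠ P in cofinite, IsGivenBy f g d φ P := hfin
  refine exists_isXMap_of_linear (hgiven.mono fun P ⟨x, y, h, hP, hne, h', hφP⟩ => ?_)
    (f₀ := f₀) (f₁ := f₁) (d₀ := d₀) (d₁ := d₁)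
  rw [hd x y h.1] at hne
  exact ⟨x, y, _, h, hP, ⟨_, _, hφP⟩, hne, by rw [hd x y h.1, hf x y h.1, div_mul_cancel₀ _ hne]⟩

end XCoordinate

section RationalFunction

open Filter Polynomial

variable {F : Type*} [Field F] {r s : F[X]}

/-- The degree of the rational function `r / s`, when `r` and `s` are coprime. -/
def ratDegree (r s : F[X]) : ℕ := max r.natDegree s.natDegree

lemma natDegree_sub_C_mul_le_ratDegree (r s : F[X]) (c : F) :
    (r - C c * s).natDegree ≤ ratDegree r s :=
  (natDegree_sub_le _ _).trans (max_le_max le_rfl (natDegree_C_mul_le _ _))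

lemma eventually_natDegree_sub_C_mul (r s : F[X]) :
    ∀ᶠ c in cofinite, (r - C c * s).natDegree = ratDegree r s := by
  obtain h0 | h0 := Nat.eq_zero_or_pos (ratDegree r s)
  · exact Eventually.of_forall fun c =>
      Nat.le_antisymm (natDegree_sub_C_mul_le_ratDegree r s c) (h0 ▸ Nat.zero_le _)
  set n := ratDegree r s with hn
  have hq : (C (r.coeff n) - C (s.coeff n) * X : F[X]) ≠ 0 := by
    intro h
    have hr : r.coeff n = 0 := by simpa using congrArg (coeff · 0) h
    have hs : s.coeff n = 0 := by simpa [coeff_C] using congrArg (coeff · 1) h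
    obtain h | h := max_choice r.natDegree s.natDegree
    · rw [hn, ratDegree, h, coeff_natDegree, leadingCoeff_eq_zero] at hr
      rw [hn, ratDegree, h, hr, natDegree_zero] at h0
      exact h0.false
    · rw [hn, ratDegree, h, coeff_natDegree, leadingCoeff_eq_zero] at hs
      rw [hn, ratDegree, h, hs, natDegree_zero] at h0
      exact h0.false
  filter_upwards [eventually_eval_ne_zero hq] with c hc
  refine (natDegree_sub_C_mul_le_ratDegree r s c).antisymm (le_natDegree_of_ne_zero ?_)
  simpa [mul_comm c] using hc

lemma eventually_sub_C_mul_ne_zero (r : F[X]) (hs : s ≠ 0) :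
    ∀ᶠ c in cofinite, r - C c * s ≠ 0 := by
  refine (Set.Subsingleton.finite (s := {c | r - C c * s = 0}) fun c hc c' hc' => ?_).subset
    fun c => not_not.1
  exact C_injective (mul_right_cancel₀ hs ((sub_eq_zero.1 hc).symm.trans (sub_eq_zero.1 hc')))

lemma eventually_exists_eval_eq_mul [IsAlgClosed F] (hrs : IsCoprime r s)
    (hpos : 0 < ratDegree r s) {q : F → Prop} (hq : ∀ᶠ x in cofinite, q x) :
    ∀ᶠ c in cofinite, ∃ x, q x ∧ r.eval x = c * s.eval x := by
  have hbad := (hq.image fun x => r.eval x / s.eval x).eventually_cofinite_notMem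
  filter_upwards [hbad, eventually_natDegree_sub_C_mul r s] with c hc hdeg
  obtain ⟨x, hx⟩ := IsAlgClosed.exists_root (r - C c * s) fun h => by
    rw [natDegree_eq_of_degree_eq_some (n := 0) h] at hdeg
    exact hpos.ne hdeg
  have hx' : r.eval x = c * s.eval x := by simpa [IsRoot, sub_eq_zero] using hx
  have hsx : s.eval x ≠ 0 := by
    intro h0
    obtain ⟨a, b, hab⟩ := hrs
    simpa [h0, hx'] using congrArg (eval x) hab
  exact ⟨x, by_contra fun h => hc ⟨x, h, (div_eq_iff hsx).2 hx'⟩, hx'⟩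

end RationalFunction

section XMap

open Filter Polynomial

variable {F : Type*} [Field F] [DecidableEq F] {V : WeierstrassCurve.Affine F}
  {φ ψ : AddMonoid.End V.Point} {r s : F[X]}

lemma eq_top_of_finite_compl {G : Type*} [AddGroup G] [Infinite G] {H : AddSubgroup G}
    (hH : ((H : Set G)ᶜ).Finite) : H = ⊤ := by
  refine (AddSubgroup.eq_top_iff' H).2 fun x => by_contra fun hx => ?_
  have hinf : (H : Set G).Infinite := fun hfin =>
    Set.infinite_univ (by simpa using hfin.union hH)
  refine (hinf.image (f := (x + ·)) (add_right_injective x).injOn) (hH.subset ?_)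
  rintro _ ⟨y, hy, rfl⟩ hmem
  exact hx ((H.add_mem_cancel_right hy).1 hmem)

namespace IsXMap

lemma ratDegree_pos (hφ : IsXMap φ r s) (htf : ∀ n : ℕ, 0 < n → n • φ ≠ 0) :
    0 < ratDegree r s := by
  by_contra! h
  have hr : r = C (r.coeff 0) := eq_C_of_natDegree_le_zero ((le_max_left _ _).trans h)
  have hs : s = C (s.coeff 0) := eq_C_of_natDegree_le_zero ((le_max_right _ _).trans h)
  have hconst : ∀ᶠ P in cofinite, HasX (φ P) (r.coeff 0 / s.coeff 0) := by
    filter_upwards [eventually_hasX hφ.2] with P ⟨x, hP, _, hx⟩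
    have := hx P hP
    rwa [hr, hs, eval_C, eval_C] at this
  let I : AddSubgroup V.Point := AddMonoidHom.range (φ : V.Point →+ V.Point)
  have hfin : (I : Set V.Point).Finite := by
    refine ((finite_setOf_hasX (V := V) (r.coeff 0 / s.coeff 0)).union (hconst.image φ)).subset ?_
    rintro _ ⟨P, rfl⟩
    exact or_iff_not_imp_left.2 fun hP => ⟨P, hP, rfl⟩
  have : Finite I := hfin.to_subtype
  refine htf (Nat.card I) Nat.card_pos ?_
  ext1 P
  exact congrArg Subtype.val (card_nsmul_eq_zero' (x := (⟨φ P, P, rfl⟩ : I)))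

lemma surjective [IsAlgClosed F] [V.IsElliptic] (hφ : IsXMap φ r s)
    (hpos : 0 < ratDegree r s) : Function.Surjective φ := by
  have := infinite_point_of_isAlgClosed (V := V)
  suffices hcofin : ∀ᶠ Q in cofinite, Q ∈ AddMonoidHom.range (φ : V.Point →+ V.Point) from
    AddMonoidHom.range_eq_top.1 (eq_top_of_finite_compl hcofin)
  filter_upwards [eventually_hasX (eventually_exists_eval_eq_mul hφ.1 hpos hφ.2)] with Q
    ⟨c, hQ, x, ⟨hsx, hx⟩, hxc⟩
  obtain ⟨P, hP⟩ := exists_hasX (V := V) x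
  have hφP := hx P hP
  rw [(div_eq_iff hsx).2 hxc] at hφP
  obtain rfl | rfl := hQ.eq_or_eq_neg hφP
  · exact ⟨P, rfl⟩
  · exact neg_mem ⟨P, rfl⟩

lemma exists_fiber_subset [IsAlgClosed F] [V.IsElliptic] (hφ : IsXMap φ r s)
    (hpos : 0 < ratDegree r s) : ∃ Q : V.Point, ∃ Z : Finset F, Z.card ≤ ratDegree r s ∧
      ∀ P, φ P = Q → ∃ x ∈ Z, HasX P x := by
  classical
  have := infinite_point_of_isAlgClosed (V := V)
  have hbad := ((eventually_hasX (V := V) hφ.2).image φ).eventually_cofinite_notMem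
  obtain ⟨Q, hQ, c, hc, hdeg⟩ :=
    (hbad.and (eventually_hasX (V := V) (eventually_natDegree_sub_C_mul r s))).exists
  have hne : r - C c * s ≠ 0 := ne_zero_of_natDegree_gt (hdeg.symm ▸ hpos)
  refine ⟨Q, (r - C c * s).roots.toFinset,
    (Multiset.toFinset_card_le _).trans ((card_roots' _).trans hdeg.le), fun P hP => ?_⟩
  obtain ⟨x, hPx, hsx, hx⟩ := by_contra fun h => hQ ⟨P, h, hP⟩
  refine ⟨x, ?_, hPx⟩
  rw [hc.unique (hP ▸ hx P hPx), Multiset.mem_toFinset, mem_roots (hc.unique (hP ▸ hx P hPx) ▸ hne)]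
  simp [hsx]

lemma finite_ker_and_ncard_ker_le [IsAlgClosed F] [V.IsElliptic] (hφ : IsXMap φ r s)
    (hpos : 0 < ratDegree r s) :
    {P | φ P = 0}.Finite ∧ {P | φ P = 0}.ncard ≤ 2 * ratDegree r s := by
  obtain ⟨Q, Z, hZ, hfiber⟩ := hφ.exists_fiber_subset hpos
  obtain ⟨P₀, rfl⟩ := hφ.surjective hpos Q
  have hinj : Set.InjOn (P₀ + ·) {P | φ P = 0} := (add_right_injective P₀).injOn
  have hsub : (P₀ + ·) '' {P | φ P = 0} ⊆ ⋃ x ∈ Z, {P : V.Point | HasX P x} := by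
    rintro _ ⟨P, hP, rfl⟩
    obtain ⟨x, hx, hPx⟩ := hfiber (P₀ + P) (by rw [map_add, show φ P = 0 from hP, add_zero])
    exact Set.mem_biUnion (x := x) hx hPx
  have hfin : (⋃ x ∈ Z, {P : V.Point | HasX P x}).Finite :=
    Z.finite_toSet.biUnion fun x _ => finite_setOf_hasX x
  refine ⟨(hfin.subset hsub).of_finite_image hinj, ?_⟩
  calc {P | φ P = 0}.ncard = ((P₀ + ·) '' {P | φ P = 0}).ncard := hinj.ncard_image.symm
    _ ≤ (⋃ x ∈ Z, {P : V.Point | HasX P x}).ncard := Set.ncard_le_ncard hsub hfin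
    _ ≤ ∑ x ∈ Z, {P : V.Point | HasX P x}.ncard := Finset.set_ncard_biUnion_le _ _
    _ ≤ Z.card * 2 := Finset.sum_le_card_nsmul _ _ _ fun x _ => ncard_setOf_hasX_le_two x
    _ ≤ 2 * ratDegree r s := by omega

end IsXMap

end XMap

section Parallelogram

open Filter Polynomial

lemma mul_dvd_of_mul_dvd_mul_of_isCoprime {A : Type*} [CommRing A] {r s r' s' d : A}
    (h : IsCoprime r s) (h' : IsCoprime r' s') (hsum : s * s' ∣ (r * s' + r' * s) * d)
    (hprod : s * s' ∣ r * r' * d) : s * s' ∣ d := by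
  obtain ⟨a, b, hab⟩ := h
  obtain ⟨a', b', hab'⟩ := h'
  have hone : 1 = (a * r + b * s) * (a' * r' + b' * s') := by rw [hab, hab', one_mul]
  obtain ⟨k, hk⟩ := hsum
  obtain ⟨l, hl⟩ := hprod
  -- With `n` as below, `1 - n ^ 2 = (1 + n) (a a' r r' + b b' s s')`, and `n ^ 2` is a combination
  -- of the three elements because `(r s') (r' s) = (r r') (s s')`.
  let n := a * b' * (r * s') + a' * b * (r' * s)
  refine ⟨((a * b') ^ 2 * (r * s') + (a' * b) ^ 2 * (r' * s)) * k
    + ((1 + n) * (a * a')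
      + (2 * a * a' * b * b' - (a * b') ^ 2 - (a' * b) ^ 2) * (s * s')) * l
    + (1 + n) * (b * b') * d, ?_⟩
  linear_combination (1 + n) * d * hone
    + ((a * b') ^ 2 * (r * s') + (a' * b) ^ 2 * (r' * s)) * hk
    + ((1 + n) * (a * a')
      + (2 * a * a' * b * b' - (a * b') ^ 2 - (a' * b) ^ 2) * (s * s')) * hl

variable {F : Type*} [Field F] {r₁ s₁ r₂ s₂ : F[X]}

/-- The numerator of `x(P + Q) + x(P - Q)` over the denominator `(r₁ s₂ - r₂ s₁) ^ 2`, where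
`x(P) = r₁ / s₁` and `x(Q) = r₂ / s₂`. -/
noncomputable def xSumNumerator (V : WeierstrassCurve.Affine F) (r₁ s₁ r₂ s₂ : F[X]) : F[X] :=
  C 2 * (r₁ * r₂ * (r₁ * s₂ + r₂ * s₁)) + C V.b₂ * (r₁ * r₂ * (s₁ * s₂))
    + C V.b₄ * ((r₁ * s₂ + r₂ * s₁) * (s₁ * s₂)) + C V.b₆ * (s₁ * s₂ * (s₁ * s₂))

/-- The numerator of `x(P + Q) x(P - Q)` over the denominator `(r₁ s₂ - r₂ s₁) ^ 2`, where
`x(P) = r₁ / s₁` and `x(Q) = r₂ / s₂`. -/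
noncomputable def xProdNumerator (V : WeierstrassCurve.Affine F) (r₁ s₁ r₂ s₂ : F[X]) : F[X] :=
  r₁ * r₂ * (r₁ * r₂) - C V.b₄ * (r₁ * r₂ * (s₁ * s₂))
    - C V.b₆ * ((r₁ * s₂ + r₂ * s₁) * (s₁ * s₂)) - C V.b₈ * (s₁ * s₂ * (s₁ * s₂))

lemma natDegree_xNumerators_le (V : WeierstrassCurve.Affine F) (r₁ s₁ r₂ s₂ : F[X]) (c : F) :
    (xProdNumerator V r₁ s₁ r₂ s₂ - C c * xSumNumerator V r₁ s₁ r₂ s₂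
      + C (c ^ 2) * (r₁ * s₂ - r₂ * s₁) ^ 2).natDegree ≤
    2 * (ratDegree r₁ s₁ + ratDegree r₂ s₂) := by
  set n := ratDegree r₁ s₁ + ratDegree r₂ s₂
  have hr₁ : r₁.natDegree ≤ ratDegree r₁ s₁ := le_max_left _ _
  have hs₁ : s₁.natDegree ≤ ratDegree r₁ s₁ := le_max_right _ _
  have hr₂ : r₂.natDegree ≤ ratDegree r₂ s₂ := le_max_left _ _
  have hs₂ : s₂.natDegree ≤ ratDegree r₂ s₂ := le_max_right _ _
  have hrr : (r₁ * r₂).natDegree ≤ n := natDegree_mul_le_of_le hr₁ hr₂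
  have hss : (s₁ * s₂).natDegree ≤ n := natDegree_mul_le_of_le hs₁ hs₂
  have hrs : (r₁ * s₂).natDegree ≤ n := natDegree_mul_le_of_le hr₁ hs₂
  have hsr : (r₂ * s₁).natDegree ≤ n := (natDegree_mul_le_of_le hr₂ hs₁).trans (add_comm _ _).le
  have add {f g : F[X]} {k : ℕ} : f.natDegree ≤ k → g.natDegree ≤ k → (f + g).natDegree ≤ k :=
    natDegree_add_le_of_degree_le
  have sub {f g : F[X]} {k : ℕ} (hf : f.natDegree ≤ k) (hg : g.natDegree ≤ k) :
      (f - g).natDegree ≤ k := (natDegree_sub_le f g).trans (max_le hf hg)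
  have mul {f g : F[X]} (hf : f.natDegree ≤ n) (hg : g.natDegree ≤ n) :
      (f * g).natDegree ≤ 2 * n := two_mul n ▸ natDegree_mul_le_of_le hf hg
  have C_mul (a : F) {f : F[X]} {k : ℕ} (hf : f.natDegree ≤ k) : (C a * f).natDegree ≤ k :=
    (natDegree_C_mul_le a f).trans hf
  have hsum : (xSumNumerator V r₁ s₁ r₂ s₂).natDegree ≤ 2 * n :=
    add (add (add (C_mul _ (mul hrr (add hrs hsr))) (C_mul _ (mul hrr hss)))
      (C_mul _ (mul (add hrs hsr) hss))) (C_mul _ (mul hss hss))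
  have hprod : (xProdNumerator V r₁ s₁ r₂ s₂).natDegree ≤ 2 * n :=
    sub (sub (sub (mul hrr hrr) (C_mul _ (mul hrr hss))) (C_mul _ (mul (add hrs hsr) hss)))
      (C_mul _ (mul hss hss))
  exact add (sub hprod (C_mul _ hsum)) (C_mul _ (natDegree_pow_le_of_le 2 (sub hrs hsr)))

lemma eq_of_eventually_eval_eq [Infinite F] {f g : F[X]}
    (h : ∀ᶠ x in cofinite, f.eval x = g.eval x) : f = g := by
  by_contra hne
  obtain ⟨x, hx, hx'⟩ := (h.and (eventually_eval_ne_zero (sub_ne_zero.2 hne))).exists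
  exact hx' (by rw [eval_sub, hx, sub_self])

variable [DecidableEq F] {V : WeierstrassCurve.Affine F} {φ ψ : AddMonoid.End V.Point}
  {r s r' s' : F[X]}

lemma HasX.exists_addX_eq {P Q : V.Point} {u v w w' : F} (hP : HasX P u) (hQ : HasX Q v)
    (hadd : HasX (P + Q) w) (hsub : HasX (P - Q) w') :
    u ≠ v ∧ ∃ y z, V.Equation u y ∧ V.Equation v z ∧ w = V.addX u v (V.slope u v y z) ∧
      w' = V.addX u v (V.slope u v y (V.negY v z)) := by
  have huv : u ≠ v := by
    rintro rfl
    obtain rfl | rfl := hP.eq_or_eq_neg hQ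
    · exact hsub.ne_zero (sub_self _)
    · exact hadd.ne_zero (neg_add_cancel _)
  obtain ⟨y, hy, rfl⟩ := hP
  obtain ⟨z, hz, rfl⟩ := hQ
  rw [WeierstrassCurve.Affine.Point.add_of_X_ne huv] at hadd
  rw [sub_eq_add_neg, WeierstrassCurve.Affine.Point.neg_some,
    WeierstrassCurve.Affine.Point.add_of_X_ne huv] at hsub
  exact ⟨huv, y, z, hy.1, hz.1, hadd.unique ⟨_, _, rfl⟩, hsub.unique ⟨_, _, rfl⟩⟩

namespace IsXMap

lemma eventually_eval_add_sub [IsAlgClosed F] [V.IsElliptic] (h₁ : IsXMap φ r₁ s₁)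
    (h₂ : IsXMap ψ r₂ s₂) (hadd : IsXMap (φ + ψ) r s) (hsub : IsXMap (φ - ψ) r' s') :
    ∀ᶠ x in cofinite, (r₁ * s₂ - r₂ * s₁).eval x ≠ 0 ∧
      ((r * s' + r' * s) * (r₁ * s₂ - r₂ * s₁) ^ 2).eval x =
        (s * s' * xSumNumerator V r₁ s₁ r₂ s₂).eval x ∧
      (r * r' * (r₁ * s₂ - r₂ * s₁) ^ 2).eval x =
        (s * s' * xProdNumerator V r₁ s₁ r₂ s₂).eval x := by
  filter_upwards [h₁.2, h₂.2, hadd.2, hsub.2] with x ⟨hs₁, hx₁⟩ ⟨hs₂, hx₂⟩ ⟨hs, hx⟩ ⟨hs', hx'⟩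
  obtain ⟨P, hP⟩ := exists_hasX (V := V) x
  obtain ⟨hne, y, z, hy, hz, hw, hw'⟩ := (hx₁ P hP).exists_addX_eq (hx₂ P hP) (hx P hP) (hx' P hP)
  have hsum := addX_slope_add_addX_slope_negY hne hy hz
  have hprod := addX_slope_mul_addX_slope_negY hne hy hz
  rw [← hw, ← hw'] at hsum hprod
  rw [Ne, div_eq_div_iff hs₁ hs₂] at hne
  simp only [xSumNumerator, xProdNumerator, eval_mul, eval_add, eval_sub, eval_pow, eval_C]
  refine ⟨sub_ne_zero.2 hne, ?_, ?_⟩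
  · field_simp at hsum
    linear_combination hsum
  · field_simp at hprod
    linear_combination hprod

/-- The numerators and the denominator of `x(P + Q) + x(P - Q)` and `x(P + Q) x(P - Q)` are
multiples of `r s' + r' s`, `r r'` and `s s'` by one polynomial `g`. Substituting a general constant
`c` in `(X - r / s) (X - r' / s')` then loses no degree. -/
theorem ratDegree_add_ratDegree_le [IsAlgClosed F] [V.IsElliptic] (h₁ : IsXMap φ r₁ s₁)
    (h₂ : IsXMap ψ r₂ s₂) (hadd : IsXMap (φ + ψ) r s) (hsub : IsXMap (φ - ψ) r' s') :
    ratDegree r s + ratDegree r' s' ≤ 2 * (ratDegree r₁ s₁ + ratDegree r₂ s₂) := by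
  have : Infinite F := IsAlgClosed.instInfinite
  have heval := h₁.eventually_eval_add_sub h₂ hadd hsub
  have hd0 : (r₁ * s₂ - r₂ * s₁) ^ 2 ≠ 0 := by
    obtain ⟨x, hx, -⟩ := heval.exists
    exact pow_ne_zero 2 fun h => hx (h ▸ eval_zero)
  have hsum := eq_of_eventually_eval_eq (heval.mono fun x hx => hx.2.1)
  have hprod := eq_of_eventually_eval_eq (heval.mono fun x hx => hx.2.2)
  obtain ⟨g, hg⟩ := mul_dvd_of_mul_dvd_mul_of_isCoprime hadd.1 hsub.1 (Dvd.intro _ hsum.symm)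
    (Dvd.intro _ hprod.symm)
  have hss : s * s' ≠ 0 := left_ne_zero_of_mul (hg ▸ hd0)
  have hg0 : g ≠ 0 := right_ne_zero_of_mul (hg ▸ hd0)
  have hsum' : xSumNumerator V r₁ s₁ r₂ s₂ = (r * s' + r' * s) * g :=
    mul_left_cancel₀ hss (by rw [← hsum, hg]; ring)
  have hprod' : xProdNumerator V r₁ s₁ r₂ s₂ = r * r' * g :=
    mul_left_cancel₀ hss (by rw [← hprod, hg]; ring)
  obtain ⟨c, ⟨hc, hc'⟩, hc0, hc0'⟩ :=
    (((eventually_natDegree_sub_C_mul r s).and (eventually_natDegree_sub_C_mul r' s')).and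
      ((eventually_sub_C_mul_ne_zero r (left_ne_zero_of_mul hss)).and
        (eventually_sub_C_mul_ne_zero r' (right_ne_zero_of_mul hss)))).exists
  have hfactor : xProdNumerator V r₁ s₁ r₂ s₂ - C c * xSumNumerator V r₁ s₁ r₂ s₂
      + C (c ^ 2) * (r₁ * s₂ - r₂ * s₁) ^ 2 = (r - C c * s) * (r' - C c * s') * g := by
    rw [hsum', hprod', hg, C_pow]
    ring
  calc ratDegree r s + ratDegree r' s'
      = ((r - C c * s) * (r' - C c * s')).natDegree := by rw [natDegree_mul hc0 hc0', hc, hc']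
    _ ≤ ((r - C c * s) * (r' - C c * s') * g).natDegree :=
        natDegree_le_of_dvd (dvd_mul_right _ _) (mul_ne_zero (mul_ne_zero hc0 hc0') hg0)
    _ ≤ 2 * (ratDegree r₁ s₁ + ratDegree r₂ s₂) :=
        hfactor ▸ natDegree_xNumerators_le V r₁ s₁ r₂ s₂ c

end IsXMap

end Parallelogram

section XDegree

variable {F : Type*} [Field F] [DecidableEq F] {V : WeierstrassCurve.Affine F}
  {φ ψ : AddMonoid.End V.Point}

/-- The degree of the map induced by `φ` on `x`-coordinates; it is `0` if there is no such map, as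
for `φ = 0`. -/
noncomputable def xDegree (φ : AddMonoid.End V.Point) : ℕ :=
  sInf {d | ∃ r s, IsXMap φ r s ∧ ratDegree r s = d}

lemma exists_isXMap_ratDegree_eq_xDegree (hφ : ∃ r s, IsXMap φ r s) :
    ∃ r s, IsXMap φ r s ∧ ratDegree r s = xDegree φ :=
  have ⟨_, _, h⟩ := hφ
  Nat.sInf_mem (s := {d | ∃ r s, IsXMap φ r s ∧ ratDegree r s = d}) ⟨_, _, _, h, rfl⟩

lemma xDegree_zero [Infinite V.Point] : xDegree (0 : AddMonoid.End V.Point) = 0 := by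
  refine Nat.sInf_eq_zero.2 (Or.inr (Set.eq_empty_of_forall_notMem ?_))
  rintro _ ⟨r, s, h, -⟩
  obtain ⟨P, x, hP, -, hx⟩ := (eventually_hasX (V := V) h.2).exists
  exact (hx P hP).ne_zero rfl

lemma xDegree_add_xDegree_le [IsAlgClosed F] [V.IsElliptic] (hφ : ∃ r s, IsXMap φ r s)
    (hψ : ∃ r s, IsXMap ψ r s) (hadd : ∃ r s, IsXMap (φ + ψ) r s)
    (hsub : ∃ r s, IsXMap (φ - ψ) r s) :
    xDegree (φ + ψ) + xDegree (φ - ψ) ≤ 2 * (xDegree φ + xDegree ψ) := by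
  obtain ⟨_, _, hφ, hφd⟩ := exists_isXMap_ratDegree_eq_xDegree hφ
  obtain ⟨_, _, hψ, hψd⟩ := exists_isXMap_ratDegree_eq_xDegree hψ
  obtain ⟨_, _, hadd, haddd⟩ := exists_isXMap_ratDegree_eq_xDegree hadd
  obtain ⟨_, _, hsub, hsubd⟩ := exists_isXMap_ratDegree_eq_xDegree hsub
  rw [← hφd, ← hψd, ← haddd, ← hsubd]
  exact hφ.ratDegree_add_ratDegree_le hψ hadd hsub

end XDegree

section Kernel

lemma card_ker_comp {A B C : Type*} [AddGroup A] [AddGroup B] [AddGroup C] (g : B →+ C)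
    {f : A →+ B} (hf : Function.Surjective f) :
    Nat.card (g.comp f).ker = Nat.card f.ker * Nat.card g.ker := by
  have hle : f.ker ≤ (g.comp f).ker := AddSubgroup.ker_le_comap f g.ker
  have hindex : f.ker.relIndex (g.comp f).ker = Nat.card g.ker := by
    rw [← AddMonoidHom.comap_bot, AddSubgroup.relIndex_comap, ← AddMonoidHom.comap_ker,
      AddSubgroup.map_comap_eq_self_of_surjective hf, AddSubgroup.relIndex_bot_left]
  rw [← AddSubgroup.relIndex_bot_left, ← AddSubgroup.relIndex_mul_relIndex _ _ _ bot_le hle, hindex,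
    AddSubgroup.relIndex_bot_left]

lemma ncard_setOf_pow_apply_eq_zero {A : Type*} [AddCommGroup A] {f : AddMonoid.End A}
    (hf : Function.Surjective f) (n : ℕ) :
    {x | (f ^ n) x = 0}.ncard = {x | f x = 0}.ncard ^ n := by
  induction n with
  | zero => exact Set.ncard_singleton (0 : A)
  | succ n ih =>
    rw [pow_succ _ n, pow_succ _ n, mul_comm (_ ^ n) (Set.ncard _), ← ih]
    exact card_ker_comp (f ^ n : AddMonoid.End A) hf

lemma exists_eq_nsmul_of_ncard_le {A : Type*} [AddCommGroup A] {p : ℕ} (hp : p.Prime)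
    (hfin : {x : A | p • x = 0}.Finite) (hcard : {x : A | p • x = 0}.ncard ≤ p) {x y : A}
    (hx : p • x = 0) (hx0 : x ≠ 0) (hy : p • y = 0) : ∃ n : ℕ, y = n • x := by
  have := Fact.mk hp
  have hord : addOrderOf x = p := addOrderOf_eq_prime hx hx0
  have hsub : (AddSubgroup.zmultiples x : Set A) ⊆ {x | p • x = 0} := by
    rintro _ ⟨k, rfl⟩
    change p • k • x = 0
    rw [smul_comm, hx, smul_zero]
  have hcardx : (AddSubgroup.zmultiples x : Set A).ncard = p :=
    (Nat.card_zmultiples x).trans hord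
  have hyx : y ∈ (AddSubgroup.zmultiples x : Set A) := by
    rwa [Set.eq_of_subset_of_ncard_le hsub (hcard.trans_eq hcardx.symm) hfin]
  obtain ⟨n, hn⟩ := (addOrderOf_pos_iff.1 (hord ▸ hp.pos)).mem_multiples_iff_mem_zmultiples.2 hyx
  exact ⟨n, hn.symm⟩

end Kernel

section Growth

lemma le_of_forall_pow_le {a b C : ℝ} (hb : 0 < b) (h : ∀ n : ℕ, a ^ n ≤ C * b ^ n) : a ≤ b := by
  by_contra! hab
  obtain ⟨n, hn⟩ := pow_unbounded_of_one_lt C ((one_lt_div hb).2 hab)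
  rw [div_pow, lt_div_iff₀ (pow_pos hb n)] at hn
  exact (h n).not_gt hn

/-- A function `h` that vanishes at `0` and satisfies one half of the parallelogram law wherever
none of the four arguments `a`, `b`, `a + b`, `a - b` is `0`. -/
structure IsSubParallelogram {G : Type*} [AddCommGroup G] (h : G → ℕ) : Prop where
  map_zero : h 0 = 0
  map_add_add_map_sub_le : ∀ a b, a ≠ 0 → b ≠ 0 → a + b ≠ 0 → a - b ≠ 0 →
    h (a + b) + h (a - b) ≤ 2 * (h a + h b)

namespace IsSubParallelogram

variable {G : Type*} [AddCommGroup G] [IsAddTorsionFree G] {h : G → ℕ} {a : G}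

lemma map_add_two_nsmul_le (hh : IsSubParallelogram h) (ha : a ≠ 0) (n : ℕ) :
    h ((n + 2) • a) ≤ h ((n + 1) • a) + h (2 • a) + 2 * n * h a := by
  induction n with
  | zero => simp
  | succ n ih =>
    have hadd : (n + 2) • a + a = (n + 1 + 2) • a := (succ_nsmul a (n + 2)).symm
    have hsub : (n + 2) • a - a = (n + 1) • a := by rw [succ_nsmul a (n + 1), add_sub_cancel_right]
    have hpar := hh.map_add_add_map_sub_le ((n + 2) • a) a (smul_ne_zero (by omega) ha) ha
      (hadd ▸ smul_ne_zero (by omega) ha) (hsub ▸ smul_ne_zero (by omega) ha)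
    rw [hadd, hsub] at hpar
    rw [show n + 1 + 1 = n + 2 from rfl]
    linarith

lemma map_succ_nsmul_le (hh : IsSubParallelogram h) (ha : a ≠ 0) (n : ℕ) :
    h ((n + 1) • a) ≤ n * h (2 • a) + (n + 1) ^ 2 * h a := by
  induction n with
  | zero => simp
  | succ n ih =>
    have hstep := hh.map_add_two_nsmul_le ha n
    rw [show n + 1 + 1 = n + 2 from rfl]
    linarith

lemma map_nsmul_le (hh : IsSubParallelogram h) (ha : a ≠ 0) (n : ℕ) :
    h (n • a) ≤ (h a + h (2 • a)) * n ^ 2 := by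
  obtain _ | n := n
  · rw [zero_smul, hh.map_zero]
    exact Nat.zero_le _
  · have hn : n * h (2 • a) ≤ (n + 1) ^ 2 * h (2 • a) := Nat.mul_le_mul_right _ (by nlinarith)
    linarith [hh.map_succ_nsmul_le ha n]

lemma exists_forall_map_zsmul_le (hh : IsSubParallelogram h) (ha : a ≠ 0) :
    ∃ C : ℕ, ∀ n : ℤ, h (n • a) ≤ C * n.natAbs ^ 2 := by
  refine ⟨max (h a + h (2 • a)) (h (-a) + h (2 • -a)), fun n => ?_⟩
  obtain ⟨m, rfl | rfl⟩ := n.eq_nat_or_neg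
  · rw [natCast_zsmul, Int.natAbs_natCast]
    exact (hh.map_nsmul_le ha m).trans (Nat.mul_le_mul_right _ (le_max_left _ _))
  · rw [neg_smul, natCast_zsmul, ← smul_neg, Int.natAbs_neg, Int.natAbs_natCast]
    exact (hh.map_nsmul_le (neg_ne_zero.2 ha) m).trans (Nat.mul_le_mul_right _ (le_max_right _ _))

lemma exists_forall_map_zsmul_add_zsmul_le (hh : IsSubParallelogram h) {b : Fin 2 → G}
    (hb : LinearIndependent ℤ b) :
    ∃ C : ℕ, ∀ x y : ℤ, h (x • b 0 + y • b 1) ≤ C * (x.natAbs ^ 2 + y.natAbs ^ 2) := by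
  have hind (x y : ℤ) (h : x • b 0 + y • b 1 = 0) : x = 0 :=
    Fintype.linearIndependent_iff.1 hb ![x, y] (by simpa [Fin.sum_univ_two] using h) 0
  obtain ⟨C₀, hC₀⟩ := hh.exists_forall_map_zsmul_le (hb.ne_zero 0)
  obtain ⟨C₁, hC₁⟩ := hh.exists_forall_map_zsmul_le (hb.ne_zero 1)
  have hsum (x y : ℤ) :
      h (x • b 0 + y • b 1) ≤ 2 * (h (x • b 0) + h (y • b 1)) := by
    by_cases hx : x = 0
    · rw [hx, zero_smul, zero_add]
      omega
    by_cases hy : y = 0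
    · rw [hy, zero_smul, add_zero]
      omega
    refine le_of_add_le_left (hh.map_add_add_map_sub_le _ _ (smul_ne_zero hx (hb.ne_zero 0))
      (smul_ne_zero hy (hb.ne_zero 1)) (fun h => hx (hind x y h)) fun h => hx (hind x (-y) ?_))
    rw [neg_smul, ← sub_eq_add_neg, h]
  refine ⟨2 * (C₀ + C₁), fun x y => (hsum x y).trans ?_⟩
  calc 2 * (h (x • b 0) + h (y • b 1))
      ≤ 2 * (C₀ * x.natAbs ^ 2 + C₁ * y.natAbs ^ 2) := by gcongr; exacts [hC₀ x, hC₁ y]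
    _ ≤ 2 * ((C₀ + C₁) * x.natAbs ^ 2 + (C₀ + C₁) * y.natAbs ^ 2) := by gcongr <;> omega
    _ = 2 * (C₀ + C₁) * (x.natAbs ^ 2 + y.natAbs ^ 2) := by ring

end IsSubParallelogram

end Growth

section ImaginaryQuadratic

open ComplexConjugate

lemma im_mul_conj_sq_mul_le (z w : ℂ) (x y : ℝ) :
    (z * conj w).im ^ 2 * (x ^ 2 + y ^ 2) ≤ (‖z‖ ^ 2 + ‖w‖ ^ 2) * ‖x * z + y * w‖ ^ 2 := by
  have him (a b : ℂ) : (a * conj b).im ^ 2 ≤ ‖a‖ ^ 2 * ‖b‖ ^ 2 := by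
    rw [← mul_pow, ← RCLike.norm_conj b, ← norm_mul, sq_le_sq, abs_norm]
    exact Complex.abs_im_le_norm _
  have hx : ((x * z + y * w) * conj w).im = x * (z * conj w).im := by
    simp only [Complex.mul_im, Complex.add_re, Complex.mul_re, Complex.ofReal_re, Complex.ofReal_im,
      zero_mul, sub_zero, Complex.conj_im, mul_neg, Complex.add_im, add_zero, Complex.conj_re]
    ring
  have hy : ((x * z + y * w) * conj z).im = -(y * (z * conj w).im) := by
    simp only [Complex.mul_im, Complex.add_re, Complex.mul_re, Complex.ofReal_re, Complex.ofReal_im,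
      zero_mul, sub_zero, Complex.conj_im, mul_neg, Complex.add_im, add_zero, Complex.conj_re]
    ring
  have hxle := him (x * z + y * w) w
  have hyle := him (x * z + y * w) z
  rw [hx, mul_pow] at hxle
  rw [hy, neg_sq, mul_pow] at hyle
  linarith

variable {K : Type u} [Field K] [NumberField K]

lemma exists_ringOfIntegers_im_ne_zero [IsTotallyComplex K] (σ : K →+* ℂ) :
    ∃ a : 𝓞 K, (σ a).im ≠ 0 := by
  by_contra! h
  refine IsTotallyComplex.complexEmbedding_not_isReal σ (ComplexEmbedding.isReal_iff.2 ?_)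
  ext k
  obtain ⟨a, c, -, rfl⟩ := IsFractionRing.div_surjective (A := 𝓞 K) k
  rw [ComplexEmbedding.conjugate_coe_eq, map_div₀, map_div₀, Complex.conj_eq_iff_im.2 (h a),
    Complex.conj_eq_iff_im.2 (h c)]

lemma im_mul_conj_basis_ne_zero [IsTotallyComplex K] (σ : K →+* ℂ)
    (b : Module.Basis (Fin 2) ℤ (𝓞 K)) : (σ (b 0) * conj (σ (b 1))).im ≠ 0 := by
  obtain ⟨a, ha⟩ := exists_ringOfIntegers_im_ne_zero σ
  have hrepr (c : 𝓞 K) : σ c = b.repr c 0 * σ (b 0) + b.repr c 1 * σ (b 1) := by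
    conv_lhs => rw [← b.sum_repr c, Fin.sum_univ_two]
    simp
  intro h0
  apply ha
  calc (σ a).im = (σ a * conj (σ (1 : 𝓞 K))).im := by simp
    _ = (b.repr a 0 * b.repr 1 1 - b.repr a 1 * b.repr 1 0) * (σ (b 0) * conj (σ (b 1))).im := by
      rw [hrepr a, hrepr 1]
      simp only [Fin.isValue, map_add, map_mul, map_intCast, Complex.mul_im, Complex.add_re,
        Complex.mul_re, Complex.intCast_re, Complex.intCast_im, zero_mul, sub_zero, Complex.add_im,
        Complex.conj_im, mul_neg, Complex.conj_re, add_zero, neg_zero]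
      ring
    _ = 0 := by rw [h0, mul_zero]

lemma exists_embedding_norm_sq [IsTotallyComplex K] (hK : Module.finrank ℚ K = 2) :
    ∃ σ : K →+* ℂ, ∀ a : 𝓞 K, ‖σ a‖ ^ 2 = (Algebra.norm ℤ a).natAbs := by
  have hcard : Fintype.card (InfinitePlace K) = 1 := by
    rw [InfinitePlace.card_eq_nrRealPlaces_add_nrComplexPlaces,
      IsTotallyComplex.nrRealPlaces_eq_zero]
    have := IsTotallyComplex.finrank (K := K)
    omega
  obtain ⟨w, hw⟩ := Fintype.card_eq_one_iff.1 hcard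
  have : Unique (InfinitePlace K) := ⟨⟨w⟩, hw⟩
  refine ⟨w.embedding, fun a => ?_⟩
  have hprod := InfinitePlace.prod_eq_abs_norm (a : K)
  rw [Fintype.prod_unique, IsTotallyComplex.mult_eq, hw default, ← Algebra.coe_norm_int] at hprod
  rw [InfinitePlace.norm_embedding_eq, hprod]
  simp

lemma exists_forall_le_mul_norm [IsTotallyComplex K] (hK : Module.finrank ℚ K = 2) {h : 𝓞 K → ℕ}
    (hh : IsSubParallelogram h) :
    ∃ C : ℝ, ∀ a : 𝓞 K, (h a : ℝ) ≤ C * (Algebra.norm ℤ a).natAbs := by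
  obtain ⟨σ, hσ⟩ := exists_embedding_norm_sq hK
  let b := Module.finBasisOfFinrankEq ℤ (𝓞 K) ((RingOfIntegers.rank K).trans hK)
  obtain ⟨C, hC⟩ := hh.exists_forall_map_zsmul_add_zsmul_le b.linearIndependent
  have hδ : 0 < (σ (b 0) * conj (σ (b 1))).im ^ 2 := by
    have := im_mul_conj_basis_ne_zero σ b
    positivity
  refine ⟨C * ((‖σ (b 0)‖ ^ 2 + ‖σ (b 1)‖ ^ 2) / (σ (b 0) * conj (σ (b 1))).im ^ 2), fun a => ?_⟩
  obtain ⟨x, y, rfl⟩ : ∃ x y : ℤ, x • b 0 + y • b 1 = a :=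
    ⟨b.repr a 0, b.repr a 1, by rw [← Fin.sum_univ_two fun i => b.repr a i • b i, b.sum_repr]⟩
  have hnorm := im_mul_conj_sq_mul_le (σ (b 0)) (σ (b 1)) x y
  have hσxy : σ (x • b 0 + y • b 1 : 𝓞 K) = (x : ℝ) * σ (b 0) + (y : ℝ) * σ (b 1) := by simp
  rw [← hσxy, hσ (_ + _), ← le_div_iff₀' hδ] at hnorm
  calc (h (x • b 0 + y • b 1) : ℝ) ≤ C * ((x : ℝ) ^ 2 + (y : ℝ) ^ 2) := by
        have := hC x y
        zify at this
        simp only [sq_abs] at this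
        exact_mod_cast this
    _ ≤ _ := by
        rw [mul_assoc, div_mul_eq_mul_div]
        exact mul_le_mul_of_nonneg_left hnorm C.cast_nonneg

lemma exists_pow_eq_span_singleton {R : Type*} [CommRing R] [IsDedekindDomain R]
    [Finite (ClassGroup R)] {I : Ideal R} (hI : I ≠ ⊥) :
    ∃ m, 0 < m ∧ ∃ α : R, I ^ m = Ideal.span {α} := by
  refine ⟨Nat.card (ClassGroup R), Nat.card_pos, ?_⟩
  let J : nonZeroDivisors (Ideal R) := ⟨I, mem_nonZeroDivisors_of_ne_zero hI⟩
  have hJ : ClassGroup.mk0 (J ^ Nat.card (ClassGroup R)) = 1 := by rw [map_pow, pow_card_eq_one']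
  obtain ⟨α, hα⟩ := ((ClassGroup.mk0_eq_one_iff (J ^ Nat.card (ClassGroup R)).2).1 hJ).principal
  exact ⟨α, hα⟩

lemma absNorm_eq_of_span_eq_mul (hK : Module.finrank ℚ K = 2) {p : ℕ} (hp : p.Prime)
    {𝔭 𝔭' : HeightOneSpectrum (𝓞 K)}
    (hsplit : Ideal.span {(p : 𝓞 K)} = 𝔭.asIdeal * 𝔭'.asIdeal) : Ideal.absNorm 𝔭.asIdeal = p := by
  have hmul : Ideal.absNorm 𝔭.asIdeal * Ideal.absNorm 𝔭'.asIdeal = p ^ 2 := by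
    rw [← map_mul, ← hsplit, Ideal.absNorm_span_natCast, RingOfIntegers.rank, hK]
  have hne_one (𝔮 : HeightOneSpectrum (𝓞 K)) : Ideal.absNorm 𝔮.asIdeal ≠ 1 :=
    fun h => 𝔮.isPrime.ne_top (Ideal.absNorm_eq_one_iff.1 h)
  exact ((hp.mul_eq_prime_sq_iff (hne_one 𝔭) (hne_one 𝔭')).1 hmul).1

end ImaginaryQuadratic

lemma mem_fixingSubgroup_adjoin_iff {F : Type*} {E : Type*} [Field F] [Field E] [Algebra F E]
    {s : Set E} {σ : Gal(E/F)} :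
    σ ∈ (IntermediateField.adjoin F s).fixingSubgroup ↔ ∀ z ∈ s, σ z = z := by
  rw [IntermediateField.mem_fixingSubgroup_iff]
  refine ⟨fun h z hz => h z (IntermediateField.subset_adjoin F s hz), fun h z hz => ?_⟩
  induction hz using IntermediateField.adjoin_induction with
  | mem z hz => exact h z hz
  | algebraMap x => exact σ.commutes x
  | add x y _ _ hx hy => rw [map_add, hx, hy]
  | inv x _ hx => rw [map_inv₀, hx]
  | mul x y _ _ hx hy => rw [map_mul, hx, hy]

namespace CMByIntegers

open WeierstrassCurve.Affine

variable {K : Type u} [Field K] {W : WeierstrassCurve.Affine K} {Kbar : Type v} [Field Kbar]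
  [Algebra K Kbar] [DecidableEq Kbar] (ι : CMByIntegers W Kbar)

lemma toEnd_mul_apply (a b : 𝓞 K) (P : (W.baseChange Kbar).Point) :
    ι.toEnd (a * b) P = ι.toEnd a (ι.toEnd b P) := by
  rw [map_mul]
  rfl

lemma toEnd_natCast_apply (n : ℕ) (P : (W.baseChange Kbar).Point) :
    ι.toEnd (n : 𝓞 K) P = n • P := by
  rw [map_natCast]
  rfl

section Degree

lemma toEnd_ne_zero {a : 𝓞 K} (ha : a ≠ 0) : ι.toEnd a ≠ 0 :=
  (map_ne_zero_iff ι.toEnd ι.injective).2 ha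

lemma nsmul_toEnd_ne_zero [CharZero K] {a : 𝓞 K} (ha : a ≠ 0) {n : ℕ} (hn : 0 < n) :
    n • ι.toEnd a ≠ 0 :=
  map_nsmul ι.toEnd n a ▸ ι.toEnd_ne_zero (smul_ne_zero hn.ne' ha)

variable [CharZero Kbar] [IsAlgClosed Kbar] [W.IsElliptic]

lemma exists_isXMap {a : 𝓞 K} (ha : a ≠ 0) : ∃ r s, IsXMap (ι.toEnd a) r s :=
  ((ι.mem_range_iff _).1 ⟨a, rfl⟩).exists_isXMap (ι.toEnd_ne_zero ha)

lemma isSubParallelogram_xDegree : IsSubParallelogram fun a => xDegree (ι.toEnd a) where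
  map_zero := by
    have := infinite_point W Kbar
    rw [map_zero, xDegree_zero]
  map_add_add_map_sub_le a b ha hb hadd hsub := by
    have hadd := ι.exists_isXMap hadd
    have hsub := ι.exists_isXMap hsub
    rw [map_add] at hadd ⊢
    rw [map_sub] at hsub ⊢
    exact xDegree_add_xDegree_le (ι.exists_isXMap ha) (ι.exists_isXMap hb) hadd hsub

variable [CharZero K]

lemma toEnd_surjective {a : 𝓞 K} (ha : a ≠ 0) : Function.Surjective (ι.toEnd a) :=
  have ⟨_, _, h⟩ := ι.exists_isXMap ha
  h.surjective (h.ratDegree_pos fun _ => ι.nsmul_toEnd_ne_zero ha)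

lemma finite_ker_and_ncard_ker_le_xDegree {a : 𝓞 K} (ha : a ≠ 0) :
    {P | ι.toEnd a P = 0}.Finite ∧ {P | ι.toEnd a P = 0}.ncard ≤ 2 * xDegree (ι.toEnd a) := by
  obtain ⟨r, s, h, hdeg⟩ := exists_isXMap_ratDegree_eq_xDegree (ι.exists_isXMap ha)
  exact hdeg ▸ h.finite_ker_and_ncard_ker_le (h.ratDegree_pos fun _ => ι.nsmul_toEnd_ne_zero ha)

end Degree

section Norm

variable [NumberField K] [IsTotallyComplex K] [CharZero Kbar] [IsAlgClosed Kbar] [W.IsElliptic]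

/-- The degree only gives the bound up to a constant factor; applying it to the powers of `a`
removes the factor, since both sides are multiplicative. -/
lemma ncard_ker_le_norm (hK : Module.finrank ℚ K = 2) {a : 𝓞 K} (ha : a ≠ 0) :
    {P | ι.toEnd a P = 0}.ncard ≤ (Algebra.norm ℤ a).natAbs := by
  obtain ⟨C, hC⟩ := exists_forall_le_mul_norm hK ι.isSubParallelogram_xDegree
  have hnorm : 0 < (Algebra.norm ℤ a).natAbs := Int.natAbs_pos.2 (Algebra.norm_ne_zero_iff.2 ha)
  rw [← Nat.cast_le (α := ℝ)]
  refine le_of_forall_pow_le (C := 2 * C) (by exact_mod_cast hnorm) fun n => ?_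
  have hker := (ι.finite_ker_and_ncard_ker_le_xDegree (pow_ne_zero n ha)).2
  rw [map_pow, ncard_setOf_pow_apply_eq_zero (ι.toEnd_surjective ha), ← map_pow] at hker
  calc ({P | ι.toEnd a P = 0}.ncard : ℝ) ^ n ≤ 2 * xDegree (ι.toEnd (a ^ n)) := by
        exact_mod_cast hker
    _ ≤ 2 * (C * (Algebra.norm ℤ (a ^ n)).natAbs) := by gcongr; exact hC (a ^ n)
    _ = 2 * C * ((Algebra.norm ℤ a).natAbs : ℝ) ^ n := by
        rw [map_pow, Int.natAbs_pow, Nat.cast_pow, mul_assoc]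

end Norm

section PrimaryTorsion

variable {p : ℕ} {𝔭 𝔭' : HeightOneSpectrum (𝓞 K)} {P : (W.baseChange Kbar).Point}

lemma exists_pow_nsmul_eq_zero (hp : (p : 𝓞 K) ∈ 𝔭.asIdeal) (hP : P ∈ ι.primaryTorsion 𝔭) :
    ∃ n : ℕ, p ^ n • P = 0 := by
  obtain ⟨n, hn⟩ := hP
  refine ⟨n, ?_⟩
  rw [← ι.toEnd_natCast_apply, Nat.cast_pow]
  exact hn _ (Ideal.pow_mem_pow hp n)

variable [NumberField K]

lemma exists_toEnd_apply_eq_self (hne : 𝔭 ≠ 𝔭') (hP : P ∈ ι.primaryTorsion 𝔭) (m : ℕ) :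
    ∃ e ∈ 𝔭'.asIdeal ^ m, ι.toEnd e P = P := by
  obtain ⟨n, hn⟩ := hP
  obtain ⟨d, hd, e, he, hde⟩ :=
    Ideal.isCoprime_iff_exists.1 (HeightOneSpectrum.isCoprime_pow_of_ne 𝔭 𝔭' hne n m)
  refine ⟨e, he, ?_⟩
  calc ι.toEnd e P = ι.toEnd d P + ι.toEnd e P := by rw [hn d hd, zero_add]
    _ = ι.toEnd (d + e) P := by rw [map_add]; rfl
    _ = P := by rw [hde, map_one]; rfl

lemma toEnd_apply_eq_zero (hne : 𝔭 ≠ 𝔭')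
    (hsplit : Ideal.span {(p : 𝓞 K)} = 𝔭.asIdeal * 𝔭'.asIdeal) {m : ℕ}
    (hP : P ∈ ι.primaryTorsion 𝔭) (hpP : p ^ m • P = 0) {a : 𝓞 K} (ha : a ∈ 𝔭.asIdeal ^ m) :
    ι.toEnd a P = 0 := by
  obtain ⟨e, he, heP⟩ := ι.exists_toEnd_apply_eq_self hne hP m
  have hae : a * e ∈ Ideal.span {((p ^ m : ℕ) : 𝓞 K)} := by
    rw [Nat.cast_pow, ← Ideal.span_singleton_pow, hsplit, mul_pow]
    exact Ideal.mul_mem_mul ha he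
  obtain ⟨c, hc⟩ := Ideal.mem_span_singleton'.1 hae
  rw [← heP, ← toEnd_mul_apply, ← hc, toEnd_mul_apply, toEnd_natCast_apply, hpP, map_zero]

variable [CharZero Kbar] [IsAlgClosed Kbar] [W.IsElliptic]

lemma exists_nsmul_eq (hp : p ≠ 0) (hne : 𝔭 ≠ 𝔭')
    (hsplit : Ideal.span {(p : 𝓞 K)} = 𝔭.asIdeal * 𝔭'.asIdeal) (hP : P ∈ ι.primaryTorsion 𝔭) :
    ∃ Q ∈ ι.primaryTorsion 𝔭, p • Q = P := by
  obtain ⟨Q, hQ⟩ := ι.toEnd_surjective (a := (p : 𝓞 K)) (by exact_mod_cast hp) P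
  obtain ⟨e, he, heP⟩ := ι.exists_toEnd_apply_eq_self hne hP 1
  obtain ⟨n, hn⟩ := hP
  refine ⟨ι.toEnd e Q, ⟨n + 1, fun a ha => ?_⟩, ?_⟩
  · have hae : a * e ∈ 𝔭.asIdeal ^ n * Ideal.span {(p : 𝓞 K)} := by
      rw [hsplit, ← mul_assoc, ← pow_succ]
      exact Ideal.mul_mem_mul ha (pow_one 𝔭'.asIdeal ▸ he)
    obtain ⟨c, hc, hce⟩ := Ideal.mem_mul_span_singleton.1 hae
    rw [← toEnd_mul_apply, ← hce, toEnd_mul_apply, hQ, hn c hc]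
  · rw [← toEnd_natCast_apply, ← toEnd_mul_apply, mul_comm, toEnd_mul_apply, hQ, heP]

lemma surjective_natCast_primaryTorsion (hp : p ≠ 0) (hne : 𝔭 ≠ 𝔭')
    (hsplit : Ideal.span {(p : 𝓞 K)} = 𝔭.asIdeal * 𝔭'.asIdeal) :
    Function.Surjective (p : AddMonoid.End (ι.primaryTorsion 𝔭)) := fun P =>
  have ⟨Q, hQ, hQP⟩ := ι.exists_nsmul_eq hp hne hsplit P.2
  ⟨⟨Q, hQ⟩, Subtype.ext hQP⟩

lemma finite_primaryTorsion_nsmul_eq_zero (𝔭 : HeightOneSpectrum (𝓞 K)) {n : ℕ} (hn : n ≠ 0) :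
    {P : ι.primaryTorsion 𝔭 | n • P = 0}.Finite := by
  refine Set.Finite.of_finite_image (f := Subtype.val)
    ((ι.finite_ker_and_ncard_ker_le_xDegree (a := (n : 𝓞 K)) (by exact_mod_cast hn)).1.subset ?_)
    Subtype.val_injective.injOn
  rintro _ ⟨P, hP, rfl⟩
  exact (ι.toEnd_natCast_apply n P).trans (congrArg Subtype.val hP)

variable [IsTotallyComplex K]

/-- If `𝔭 ^ m = (α)`, then the `p ^ m`-torsion of `E[𝔭^∞]` is killed by `α`, whose norm is
`p ^ m`. -/
lemma ncard_primaryTorsion_nsmul_eq_zero_le (hK : Module.finrank ℚ K = 2) (hp : p.Prime)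
    (hne : 𝔭 ≠ 𝔭') (hsplit : Ideal.span {(p : 𝓞 K)} = 𝔭.asIdeal * 𝔭'.asIdeal) :
    {P : ι.primaryTorsion 𝔭 | p • P = 0}.ncard ≤ p := by
  obtain ⟨m, hm, α, hα⟩ := exists_pow_eq_span_singleton 𝔭.ne_bot
  have hnorm : (Algebra.norm ℤ α).natAbs = p ^ m := by
    rw [← Ideal.absNorm_span_singleton, ← hα, map_pow, absNorm_eq_of_span_eq_mul hK hp hsplit]
  have hα0 : α ≠ 0 := by
    rintro rfl
    rw [Algebra.norm_zero] at hnorm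
    exact pow_ne_zero m hp.ne_zero hnorm.symm
  have hpow : {P : ι.primaryTorsion 𝔭 | p ^ m • P = 0}.ncard =
      {P : ι.primaryTorsion 𝔭 | p • P = 0}.ncard ^ m := by
    have := ncard_setOf_pow_apply_eq_zero
      (ι.surjective_natCast_primaryTorsion hp.ne_zero hne hsplit) m
    rwa [← Nat.cast_pow] at this
  have hsub : Subtype.val '' {P : ι.primaryTorsion 𝔭 | p ^ m • P = 0} ⊆ {P | ι.toEnd α P = 0} := by
    rintro _ ⟨P, hP, rfl⟩
    exact ι.toEnd_apply_eq_zero hne hsplit P.2 (congrArg Subtype.val hP)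
      (hα ▸ Ideal.mem_span_singleton_self α)
  refine (Nat.pow_le_pow_iff_left hm.ne').1 ?_
  calc {P : ι.primaryTorsion 𝔭 | p • P = 0}.ncard ^ m
      = (Subtype.val '' {P : ι.primaryTorsion 𝔭 | p ^ m • P = 0}).ncard := by
        rw [← hpow, Set.ncard_image_of_injective _ Subtype.val_injective]
    _ ≤ {P | ι.toEnd α P = 0}.ncard :=
        Set.ncard_le_ncard hsub (ι.finite_ker_and_ncard_ker_le_xDegree hα0).1
    _ ≤ p ^ m := hnorm ▸ ι.ncard_ker_le_norm hK hα0

theorem isQuasiCyclic_primaryTorsion (hK : Module.finrank ℚ K = 2) (hp : p.Prime) (hne : 𝔭 ≠ 𝔭')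
    (hsplit : Ideal.span {(p : 𝓞 K)} = 𝔭.asIdeal * 𝔭'.asIdeal) :
    IsQuasiCyclic p (ι.primaryTorsion 𝔭) where
  exists_pow_smul_eq_zero P := by
    have hmem : (p : 𝓞 K) ∈ 𝔭.asIdeal * 𝔭'.asIdeal := by
      rw [← hsplit]
      exact Ideal.mem_span_singleton_self _
    obtain ⟨n, hn⟩ := ι.exists_pow_nsmul_eq_zero (Ideal.mul_le_inf hmem).1 P.2
    exact ⟨n, Subtype.ext hn⟩
  exists_smul_eq := ι.surjective_natCast_primaryTorsion hp.ne_zero hne hsplit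
  exists_eq_smul _ _ := exists_eq_nsmul_of_ncard_le hp
    (ι.finite_primaryTorsion_nsmul_eq_zero 𝔭 hp.ne_zero)
    (ι.ncard_primaryTorsion_nsmul_eq_zero_le hK hp hne hsplit)

end PrimaryTorsion

section Galois

variable [IsAlgClosure K Kbar] [W.IsElliptic] {𝔭 : HeightOneSpectrum (𝓞 K)}

lemma galoisRep_some_eq_iff {x y : Kbar} {h : (W.baseChange Kbar).Nonsingular x y}
    (hP : .some x y h ∈ ι.primaryTorsion 𝔭) (σ : Gal(Kbar/K)) :
    ι.galoisRep 𝔭 σ ⟨.some x y h, hP⟩ = ⟨.some x y h, hP⟩ ↔ σ x = x ∧ σ y = y := by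
  rw [Subtype.ext_iff]
  change Point.some (σ x) (σ y) _ = .some x y h ↔ _
  exact (Point.some.injEq ..).to_iff

lemma isOpen_galoisRep_eq (P : ι.primaryTorsion 𝔭) : IsOpen {σ | ι.galoisRep 𝔭 σ P = P} := by
  obtain ⟨_ | ⟨x, y, h⟩, hP⟩ := P
  · convert isOpen_univ
    exact Set.eq_univ_of_forall fun σ => map_zero (ι.galoisRep 𝔭 σ)
  have : Algebra.IsAlgebraic K Kbar := IsAlgClosure.isAlgebraic
  convert (stabilizer_isOpen_of_isIntegral (K := K) x).inter
    (stabilizer_isOpen_of_isIntegral (K := K) y)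
  ext σ
  exact ι.galoisRep_some_eq_iff hP σ

lemma fixingSubgroup_divisionField (L : IntermediateField K Kbar) :
    (ι.divisionField 𝔭 L).fixingSubgroup = L.fixingSubgroup ⊓ (ι.galoisRep 𝔭).ker := by
  rw [divisionField, IntermediateField.fixingSubgroup_sup]
  congr 1
  ext σ
  rw [mem_fixingSubgroup_adjoin_iff, mem_ker_iff_forall_apply]
  constructor
  · rintro h ⟨_ | ⟨x, y, hxy⟩, hP⟩
    · exact map_zero (ι.galoisRep 𝔭 σ)
    · exact (ι.galoisRep_some_eq_iff hP σ).2
        ⟨h x ⟨x, y, hxy, hP, Or.inl rfl⟩, h y ⟨x, y, hxy, hP, Or.inr rfl⟩⟩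
  · rintro h z ⟨x, y, hxy, hP, rfl | rfl⟩
    · exact ((ι.galoisRep_some_eq_iff hP σ).1 (h _)).1
    · exact ((ι.galoisRep_some_eq_iff hP σ).1 (h _)).2

end Galois

end CMByIntegers

theorem mainTheorem7_general {K : Type u} [Field K] [NumberField K] [IsTotallyComplex K]
    (hK : Module.finrank ℚ K = 2) {p : ℕ} (hp : p.Prime) (hp2 : p ≠ 2)
    {𝔭 𝔭' : HeightOneSpectrum (𝓞 K)} (hne : 𝔭 ≠ 𝔭')
    (hsplit : Ideal.span {(p : 𝓞 K)} = 𝔭.asIdeal * 𝔭'.asIdeal)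
    {Kbar : Type v} [Field Kbar] [Algebra K Kbar] [IsAlgClosure K Kbar] [DecidableEq Kbar]
    {W : WeierstrassCurve.Affine K} [W.IsElliptic] (ι : CMByIntegers W Kbar)
    (L : IntermediateField K Kbar) [IsGalois K L] (S : Finset (HeightOneSpectrum (𝓞 K))) :
    (∃ e : imprimitiveSelmer (ι.galoisRep 𝔭) S L ≃+
        selmerInvariants (ι.galoisRep 𝔭) S L (ι.divisionField 𝔭 L),
      ∀ c : imprimitiveSelmer (ι.galoisRep 𝔭) S L,
        (e c : galH1 (ι.galoisRep 𝔭) (ι.divisionField 𝔭 L)) =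
          galRes (ι.galoisRep 𝔭) (ι.le_divisionField 𝔭 L) c) ∧
    (∀ (σ : Gal(Kbar/K)) (c : galH1 (ι.galoisRep 𝔭) L),
      galRes (ι.galoisRep 𝔭) (ι.le_divisionField 𝔭 L) (galConj (ι.galoisRep 𝔭) L σ c) =
        galConj (ι.galoisRep 𝔭) (ι.divisionField 𝔭 L) σ
          (galRes (ι.galoisRep 𝔭) (ι.le_divisionField 𝔭 L) c)) := by
  have : IsAlgClosed Kbar := IsAlgClosure.isAlgClosed K
  have : CharZero Kbar := charZero_of_injective_algebraMap (algebraMap K Kbar).injective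
  have hA := ι.isQuasiCyclic_primaryTorsion hK hp hne hsplit
  exact ⟨exists_selmer_equiv hA hp hp2 ι.isOpen_galoisRep_eq (ι.le_divisionField 𝔭 L)
    (ι.fixingSubgroup_divisionField L) S, galConj_galRes (ι.le_divisionField 𝔭 L)⟩

theorem mainTheorem7 {K : Type u} [Field K] [NumberField K] [IsTotallyComplex K]
    (hK : Module.finrank ℚ K = 2)
    (p : ℕ) [Fact p.Prime] (hp : 5 ≤ p)
    (𝔭 𝔭' : HeightOneSpectrum (𝓞 K)) (hne : 𝔭 ≠ 𝔭')
    (hsplit : Ideal.span {(p : 𝓞 K)} = 𝔭.asIdeal * 𝔭'.asIdeal)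
    {Kbar : Type v} [Field Kbar] [Algebra K Kbar] [IsAlgClosure K Kbar]
    [DecidableEq Kbar]
    (E : WeierstrassCurve ℚ) [E.IsElliptic]
    (hgood : ((E.baseChange ℚ_[p]).minimal ℤ_[p]).HasGoodReduction ℤ_[p])
    (ι : CMByIntegers (E.baseChange K) Kbar)
    (L : IntermediateField K Kbar) [FiniteDimensional K L] [IsAbelianGalois K L]
    (S : Finset (HeightOneSpectrum (𝓞 K))) (hS : 𝔭 ∈ S) (hS' : 𝔭' ∉ S) :
    (∃ e : imprimitiveSelmer (ι.galoisRep 𝔭) S L ≃+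
        selmerInvariants (ι.galoisRep 𝔭) S L (ι.divisionField 𝔭 L),
      ∀ c : imprimitiveSelmer (ι.galoisRep 𝔭) S L,
        (e c : galH1 (ι.galoisRep 𝔭) (ι.divisionField 𝔭 L)) =
          galRes (ι.galoisRep 𝔭) (ι.le_divisionField 𝔭 L) c) ∧
    (∀ (σ : Gal(Kbar/K)) (c : galH1 (ι.galoisRep 𝔭) L),
      galRes (ι.galoisRep 𝔭) (ι.le_divisionField 𝔭 L) (galConj (ι.galoisRep 𝔭) L σ c) =
        galConj (ι.galoisRep 𝔭) (ι.divisionField 𝔭 L) σ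
          (galRes (ι.galoisRep 𝔭) (ι.le_divisionField 𝔭 L) c)) :=
  mainTheorem7_general hK Fact.out (by omega) hne hsplit ι L S
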